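/- **Weighted graphs.** A (row-finite) weighted graph $(E,\omega)$ consists of a set $E^0$ of vertices, a set $E^{\mathrm{st}}$ of structured edges, maps $s,r:E^{\mathrm{st}}\to E^0$ with $s^{-1}(v)$ finite for every $v\in E^0$, and a weight map $\omega:E^{\mathrm{st}}\to\{1,2,\dots\}$. Its edges are distinct symbols $\alpha_i$ ($\alpha\in E^{\mathrm{st}}$, $1\le i\le\omega(\alpha)$), with ghost edges $\alpha_i^*$; put $s(\alpha_i)=r(\alpha_i^*)=s(\alpha)$, $r(\alpha_i)=s(\alpha_i^*)=r(\alpha)$ and $s(v)=r(v)=v$ for $v\in E^0$. A vertex $v$ is a sink if $s^{-1}(v)=\emptyset$; otherwise put $\omega(v)=\max\{\omega(\alpha): s(\alpha)=v\}$. A generalised path $p$ is either a single vertex (of length $|p|=0$) or a word $x_1\cdots x_n$, $n\ge 1$, in edges and ghost edges with $r(x_i)=s(x_{i+1})$ for $1\le i<n$ (of length $|p|=n$); its source is $s(x_1)$ and its range is $r(x_n)$. $(E,\omega)$ is an *LV-graph* if $\omega(\alpha)\ge 2$ for all $\alpha\in E^{\mathrm{st}}$; if for every non-sink $v$ at least two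 $\alpha\in s^{-1}(v)$ satisfy $\omega(\alpha)=\omega(v)$; if $E^{\mathrm{st}}\ne\emptyset$; and if any two vertices are joined by a generalised path. **The algebra.** Let $R$ be a unital ring, let $X$ be the set of all vertices, edges and ghost edges, and let $R\langle X\rangle$ be the free $R$-ring on $X$ (the free left $R$-module on the nonempty words over $X$, with $(rp)(tq)=(rt)(pq)$ for $r,t\in R$ and words $p,q$). The weighted Leavitt path algebra is $L=L_R(E,\omega)=R\langle X\rangle/I$, where $I$ is the two-sided ideal and $R$-subbimodule generated by the relations 1. $vw=\delta_{vw}v$ for $v,w\in E^0$; 2. $s(\alpha)\alpha_i=\alpha_i=\alpha_i r(\alpha)$ and $r(\alpha)\alpha_i^*=\alpha_i^*=\alpha_i^*s(\alpha)$ for $\alpha\in E^{\mathrm{st}}$, $1\le i\le\omega(\alpha)$; 3. $\sum_{s(\alpha)=v}\alpha_i\alpha_j^*=\delta_{ij}v$ for every non-sink $v$ and $1\le i,j\le\omega(v)$; 4. $\sum_{1\le i\le\max\{\omega(\alpha),\omega(\beta)\}}\alpha_i^*\beta_i=\delta_{\alpha\beta}r(\alpha)$ for $\alpha,\beta\in E^{\mathrm{st}}$;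 here $\alpha_i$ and $\alpha_i^*$ are read as $0$ when $i>\omega(\alpha)$. **Normal forms.** For every non-sink $v$ fix any $\alpha^v\in E^{\mathrm{st}}$ with $s(\alpha^v)=v$ and $\omega(\alpha^v)=\omega(v)$. A generalised path is *normal* if it contains no subword of the form $\alpha^v_i(\alpha^v_j)^*$ ($v$ a non-sink, $1\le i,j\le\omega(\alpha^v)$) and no subword of the form $\alpha_1^*\beta_1$ ($\alpha,\beta\in E^{\mathrm{st}}$). A normal representative of $a\in L$ is an $R$-linear combination of normal generalised paths in $R\langle X\rangle$ whose class is $a$. When it exists and is unique, it is denoted $\mathrm{NF}(a)$, and $\mathrm{supp}(a)$ is the set of generalised paths occurring in $\mathrm{NF}(a)$ with nonzero coefficient. **Proposition.** Let $(E,\omega)$ be an LV-graph and let $R$ be a (not necessarily commutative) domain. Then every $a\in L_R(E,\omega)$ has exactly one normal representative $\mathrm{NF}(a)$, and the map $$\nu:L_R(E,\omega)\to\mathbb N_0\cup\{-\infty\},\qquad \nu(a)=\max\{|p| : p\in\mathrm{supp}(a)\}\quad(\max\emptyset=-\infty)$$ is a *local valuation* on $L=L_R(E,\omega)$, that is: 1.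 $\nu(a)=-\infty$ if and only if $a=0$; 2. $\nu(a)=0$ if and only if $a\ne 0$ and $\mathrm{supp}(a)\subseteq E^0$; 3. $\nu(a+b)\le\max\{\nu(a),\nu(b)\}$ for all $a,b\in L$; 4. $\nu(ab)=\nu(a)+\nu(b)$ for all $v\in E^0$, $a\in Lv$ and $b\in vL$, where $x+(-\infty)=(-\infty)+x=-\infty$. -/

import Mathlib

noncomputable section

universe u v w

/-- A row-finite weighted graph with vertex set `V` and set of structured edges `S`.
A structured edge `α` carries the edges `α_1, …, α_{ω(α)}`. -/
structure WeightedGraph (V : Type u) (S : Type v) where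
  src : S → V
  tgt : S → V
  weight : S → ℕ
  weight_pos : ∀ α, 0 < weight α
  rowFinite : ∀ x : V, {α : S | src α = x}.Finite

namespace WeightedGraph

variable {V : Type u} {S : Type v} (E : WeightedGraph V S)

/-- The finite set of structured edges with source `x`. -/
def outEdges (x : V) : Finset S := (E.rowFinite x).toFinset

/-- `x` is not a sink. -/
def NotSink (x : V) : Prop := ∃ α : S, E.src α = x

/-- The weight of a vertex, `max {ω(α) | s(α) = x}` (only meaningful when `x` is not a sink;
it is `0` for a sink). -/
def vertexWeight (x : V) : ℕ := (E.outEdges x).sup E.weight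

/-- The alphabet consisting of the vertices, the edges `α_i` and the ghost edges `α_i^*`.
Indices are shifted by one: `i : Fin (ω α)` stands for the index `i + 1`. -/
inductive Letter (E : WeightedGraph V S) : Type (max u v)
  | vertex (x : V) : Letter E
  | edge (α : S) (i : Fin (E.weight α)) : Letter E
  | ghost (α : S) (i : Fin (E.weight α)) : Letter E

variable {E} in
/-- Source of a letter. -/
def Letter.src : Letter E → V
  | .vertex x => x
  | .edge α _ => E.src α
  | .ghost α _ => E.tgt α

variable {E} in
/-- Range of a letter. -/
def Letter.tgt : Letter E → V
  | .vertex x => x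
  | .edge α _ => E.tgt α
  | .ghost α _ => E.src α

variable {E} in
/-- The letter is a vertex. -/
def Letter.IsVertex (x : Letter E) : Prop := ∃ y : V, x = .vertex y

/-- The nonempty words over the alphabet. -/
abbrev Word := FreeSemigroup E.Letter

variable {E} in
/-- The list of letters of a word. -/
def Word.letters (p : E.Word) : List E.Letter := p.head :: p.tail

variable {E} in
/-- Source of a word: source of its first letter. -/
def Word.src (p : E.Word) : V := p.head.src

variable {E} in
/-- Range of a word: range of its last letter. -/
def Word.tgt (p : E.Word) : V := (p.letters.getLast (List.cons_ne_nil _ _)).tgt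

variable {E} in
/-- The word consists of a single letter, which is a vertex. -/
def Word.IsTrivial (p : E.Word) : Prop := ∃ x : V, p = FreeSemigroup.of (.vertex x)

variable {E} in
/-- Generalised paths: single vertices, and words `x_1 … x_n` in the edges and ghost edges with
`r(x_i) = s(x_{i+1})`. -/
def Word.IsGenPath (p : E.Word) : Prop :=
  p.IsTrivial ∨
    ((∀ x ∈ p.letters, ¬ x.IsVertex) ∧ p.letters.IsChain (fun x y => x.tgt = y.src))

variable {E} in
open Classical in
/-- The length of a generalised path: `0` for a vertex, the number of letters otherwise. -/
def Word.pathLength (p : E.Word) : ℕ := if p.IsTrivial then 0 else p.letters.length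

/-- There is exactly one connected component: there is a vertex, and any two vertices are joined
by a generalised path. -/
def IsConnected : Prop :=
  Nonempty V ∧ ∀ x y : V, ∃ p : E.Word, p.IsGenPath ∧ p.src = x ∧ p.tgt = y

/-- LV-graphs. -/
structure IsLV : Prop where
  two_le_weight : ∀ α : S, 2 ≤ E.weight α
  two_le_card : ∀ x : V, E.NotSink x →
    2 ≤ ((E.outEdges x).filter (fun α => E.weight α = E.vertexWeight x)).card
  nonempty_edges : Nonempty S
  connected : E.IsConnected

/-- A choice, for each vertex `x` that is not a sink, of a structured edge `α^x` with source `x`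
and of maximal weight among the structured edges with source `x`. -/
structure SpecialEdges where
  edge : {x : V // E.NotSink x} → S
  src_edge : ∀ x, E.src (edge x) = x.1
  weight_edge : ∀ x, E.weight (edge x) = E.vertexWeight x.1

variable {E} in
/-- Words of type I: `α^x_i (α^x_j)^*`. -/
def Word.IsTypeI (c : E.SpecialEdges) (p : E.Word) : Prop :=
  ∃ (x : {x : V // E.NotSink x}) (i j : Fin (E.weight (c.edge x))),
    p = FreeSemigroup.of (.edge (c.edge x) i) * FreeSemigroup.of (.ghost (c.edge x) j)

variable {E} in
/-- Words of type II: `α_1^* β_1`. -/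
def Word.IsTypeII (p : E.Word) : Prop :=
  ∃ α β : S, p = FreeSemigroup.of (.ghost α ⟨0, E.weight_pos α⟩) *
    FreeSemigroup.of (.edge β ⟨0, E.weight_pos β⟩)

variable {E} in
/-- Normal generalised paths: those without subwords of type I or II. -/
def Word.IsNormal (c : E.SpecialEdges) (p : E.Word) : Prop :=
  p.IsGenPath ∧
    ∀ q : E.Word, q.IsTypeI c ∨ q.IsTypeII → ¬ q.letters <:+: p.letters

variable (R : Type w) [Ring R]

/-- The free (non-unital) `R`-ring on the alphabet: the free left `R`-module on the nonempty words
with `(r p) (s q) = (r s) (p q)`. -/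
abbrev FreeRing := MonoidAlgebra R E.Word

/-- A word as an element of the free `R`-ring. -/
def word (p : E.Word) : E.FreeRing R := MonoidAlgebra.single p 1

/-- A vertex as an element of the free `R`-ring. -/
def vertexElt (x : V) : E.FreeRing R := E.word R (FreeSemigroup.of (.vertex x))

/-- `edgeElt α i` is `α_{i+1}`, understood to be zero if `i + 1 > ω(α)`. -/
def edgeElt (α : S) (i : ℕ) : E.FreeRing R :=
  if h : i < E.weight α then E.word R (FreeSemigroup.of (.edge α ⟨i, h⟩)) else 0

/-- `ghostElt α i` is `α_{i+1}^*`, understood to be zero if `i + 1 > ω(α)`. -/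
def ghostElt (α : S) (i : ℕ) : E.FreeRing R :=
  if h : i < E.weight α then E.word R (FreeSemigroup.of (.ghost α ⟨i, h⟩)) else 0

open Classical in
/-- The defining relations: `Rel a b` stands for the relation `a = b`. -/
inductive Rel : E.FreeRing R → E.FreeRing R → Prop
  | vertex_mul (x y : V) :
      Rel (E.vertexElt R x * E.vertexElt R y) (if x = y then E.vertexElt R x else 0)
  | src_mul_edge (α : S) (i : ℕ) (hi : i < E.weight α) :
      Rel (E.vertexElt R (E.src α) * E.edgeElt R α i) (E.edgeElt R α i)
  | edge_mul_tgt (α : S) (i : ℕ) (hi : i < E.weight α) :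
      Rel (E.edgeElt R α i * E.vertexElt R (E.tgt α)) (E.edgeElt R α i)
  | tgt_mul_ghost (α : S) (i : ℕ) (hi : i < E.weight α) :
      Rel (E.vertexElt R (E.tgt α) * E.ghostElt R α i) (E.ghostElt R α i)
  | ghost_mul_src (α : S) (i : ℕ) (hi : i < E.weight α) :
      Rel (E.ghostElt R α i * E.vertexElt R (E.src α)) (E.ghostElt R α i)
  | sum_edge_mul_ghost (x : V) (i j : ℕ) (hi : i < E.vertexWeight x)
      (hj : j < E.vertexWeight x) :
      Rel (∑ α ∈ E.outEdges x, E.edgeElt R α i * E.ghostElt R α j)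
        (if i = j then E.vertexElt R x else 0)
  | sum_ghost_mul_edge (α β : S) :
      Rel (∑ i ∈ Finset.range (max (E.weight α) (E.weight β)),
          E.ghostElt R α i * E.edgeElt R β i)
        (if α = β then E.vertexElt R (E.tgt α) else 0)

/-- The ideal of the free `R`-ring generated by the defining relations: the smallest two-sided
ideal that is an `R`-subbimodule and contains `a - b` for every relation `a = b`. -/
def relIdeal : TwoSidedIdeal (E.FreeRing R) :=
  sInf {J | (∀ (r : R), ∀ a ∈ J, r • a ∈ J ∧ MulOpposite.op r • a ∈ J) ∧
    ∀ a b, E.Rel R a b → a - b ∈ J}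

/-- The weighted Leavitt path algebra `L_R(E, ω)`, as a non-unital ring. -/
abbrev LPA := (E.relIdeal R).ringCon.Quotient

/-- The quotient map from the free `R`-ring to the weighted Leavitt path algebra. -/
def toLPA (f : E.FreeRing R) : E.LPA R := (f : (E.relIdeal R).ringCon.Quotient)

/-- A vertex as an element of the weighted Leavitt path algebra. -/
def vertexLPA (x : V) : E.LPA R := E.toLPA R (E.vertexElt R x)

variable {E R}

/-- Normal elements of the free `R`-ring: linear combinations of normal generalised paths. -/
def IsNormalElt (c : E.SpecialEdges) (f : E.FreeRing R) : Prop :=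
  ∀ p ∈ f.coeff.support, p.IsNormal c

/-- `f` is a normal representative of `a`. -/
def IsNormalRep (c : E.SpecialEdges) (a : E.LPA R) (f : E.FreeRing R) : Prop :=
  IsNormalElt c f ∧ E.toLPA R f = a

open Classical in
/-- The normal form of `a`: its (unique) normal representative. The value `0` is taken if there is
no normal representative. -/
def NF (c : E.SpecialEdges) (a : E.LPA R) : E.FreeRing R :=
  if h : ∃ f, IsNormalRep c a f then h.choose else 0

/-- The support of `a`: the words occurring in the normal form of `a`. -/
def supp (c : E.SpecialEdges) (a : E.LPA R) : Finset E.Word := (NF c a).coeff.support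

/-- Local valuations on the weighted Leavitt path algebra; `⊥ : WithBot ℕ` is `-∞`. -/
structure IsLocalValuation (c : E.SpecialEdges) (ν : E.LPA R → WithBot ℕ) : Prop where
  eq_bot_iff : ∀ a, ν a = ⊥ ↔ a = 0
  eq_zero_iff : ∀ a, ν a = 0 ↔ a ≠ 0 ∧ ∀ p ∈ supp c a, p.IsTrivial
  add_le : ∀ a b, ν (a + b) ≤ max (ν a) (ν b)
  mul_eq : ∀ (x : V) (a b : E.LPA R), (∃ a', a = a' * E.vertexLPA R x) →
    (∃ b', b = E.vertexLPA R x * b') → ν (a * b) = ν a + ν b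

/-- The maximal length of a path in the support of `a`, with `max ∅ = -∞`. -/
def maxLength (c : E.SpecialEdges) (a : E.LPA R) : WithBot ℕ :=
  (supp c a).sup (fun p => (p.pathLength : WithBot ℕ))

end WeightedGraph

end

/-!
Call the junctions forbidden in normal paths redexes, and call the set of all pairs of letters that
occur together in one of the sums of relations (3) and (4) a block. Every nonempty block contains
exactly one redex, so these relations rewrite a redex as minus the sum of the other pairs of its
block, modulo shorter paths. Rewriting after multiplication by a letter on the left defines an
action of the free ring on the combinations of normal paths. Two rewritings interfere only in a word
`y z t` in which both `y z` and `z t` are redexes, and there both orders agree, so the defining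
relations hold for this action. A normal path applied to its range gives back this path, hence
normal paths are linearly independent in `L`.

For the valuation, let `m` and `n` have leading paths `P y` and `z Q`. If `y z` lies in no block,
the coefficient of `P y z Q` in the product is `m(P y) n(z Q)`. Otherwise let `y₀ z₀` be the redex
in the block of `y z`. For every other pair `y' z'` of the block, `P y' z' Q` has coefficient
`m(P y') n(z' Q) - m(P y₀) n(z₀ Q)`. If all coefficients in top degree vanished, these products
would agree for all pairs of the block and hence be nonzero, as they are for `y z`. The conditions
on the weights provide a pair `y' z'` other than `y z` in the block. Now `y z'` lies in no block,
and `P y z' Q` has the coefficient `m(P y) n(z' Q) ≠ 0`.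
-/

noncomputable section

open scoped Classical

namespace WeightedGraph

universe u v w

variable {V : Type u} {S : Type v} {E : WeightedGraph V S} {c : E.SpecialEdges}

lemma mem_outEdges {α : S} {x : V} : α ∈ E.outEdges x ↔ E.src α = x := by
  simp [outEdges]

lemma weight_le_vertexWeight (α : S) : E.weight α ≤ E.vertexWeight (E.src α) :=
  Finset.le_sup (f := E.weight) (mem_outEdges.2 rfl)

lemma notSink_of_lt_vertexWeight {x : V} {i : ℕ} (hi : i < E.vertexWeight x) : E.NotSink x := by
  obtain ⟨α, hα, -⟩ := Finset.lt_sup_iff.1 hi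
  exact ⟨α, mem_outEdges.1 hα⟩

/-- A special structured edge is one of the chosen edges `α^x`. -/
def SpecialEdges.IsSpecial (c : E.SpecialEdges) (α : S) : Prop := ∃ x, c.edge x = α

namespace SpecialEdges

lemma IsSpecial.eq_of_src_eq {α β : S} (hα : c.IsSpecial α) (hβ : c.IsSpecial β)
    (h : E.src α = E.src β) : α = β := by
  obtain ⟨⟨x, hx⟩, rfl⟩ := hα
  obtain ⟨⟨y, hy⟩, rfl⟩ := hβ
  simp only [c.src_edge] at h
  subst h
  rfl

lemma IsSpecial.weight_eq {α : S} (hα : c.IsSpecial α) :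
    E.weight α = E.vertexWeight (E.src α) := by
  obtain ⟨x, rfl⟩ := hα
  rw [c.weight_edge, c.src_edge]

lemma IsSpecial.weight_le {α β : S} (hα : c.IsSpecial α) (h : E.src β = E.src α) :
    E.weight β ≤ E.weight α := by
  rw [hα.weight_eq, ← h]
  exact weight_le_vertexWeight β

lemma exists_isSpecial (c : E.SpecialEdges) {x : V} (hx : E.NotSink x) :
    ∃ α, c.IsSpecial α ∧ E.src α = x :=
  ⟨_, ⟨⟨x, hx⟩, rfl⟩, c.src_edge _⟩

end SpecialEdges

/-! ### Blocks and redexes -/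

namespace Letter

/-- The involution exchanging the edge `α_i` with the ghost edge `α_i^*` and fixing the vertices. -/
def star : E.Letter → E.Letter
  | .vertex x => .vertex x
  | .edge α i => .ghost α i
  | .ghost α i => .edge α i

@[simp] lemma star_star (y : E.Letter) : y.star.star = y := by cases y <;> rfl

@[simp] lemma src_star (y : E.Letter) : y.star.src = y.tgt := by cases y <;> rfl

@[simp] lemma tgt_star (y : E.Letter) : y.star.tgt = y.src := by cases y <;> rfl

/-- The block of a pair of letters: all pairs that occur together with it in one of the sums
`∑ α_i α_j^*` over `α ∈ s⁻¹(v)` and `∑ α_i^* β_i` over `i` of the defining relations. It is empty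
if the pair occurs in none of them. -/
def block : E.Letter → E.Letter → Finset (E.Letter × E.Letter)
  | .edge α i, .ghost β j =>
      if α = β then
        (E.outEdges (E.src α)).biUnion fun γ =>
          if h : i.val < E.weight γ ∧ j.val < E.weight γ then
            {(.edge γ ⟨i, h.1⟩, .ghost γ ⟨j, h.2⟩)}
          else ∅
      else ∅
  | .ghost α i, .edge β j =>
      if i.val = j.val then
        (Finset.range (max (E.weight α) (E.weight β))).biUnion fun k =>
          if h : k < E.weight α ∧ k < E.weight β then {(.ghost α ⟨k, h.1⟩, .edge β ⟨k, h.2⟩)}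
          else ∅
      else ∅
  | _, _ => ∅

/-- Redexes are the forbidden junctions of a normal path: `α^x_i (α^x_j)^*` and `α_1^* β_1`
(the latter has index `0` in this encoding). Every nonempty block contains exactly one of them. -/
def IsRedex (c : E.SpecialEdges) : E.Letter → E.Letter → Prop
  | .edge α _, .ghost β _ => α = β ∧ c.IsSpecial α
  | .ghost _ i, .edge _ j => i.val = 0 ∧ j.val = 0
  | _, _ => False

/-- The pairs whose negatives replace the redex `y z` modulo shorter paths. -/
def reducts (y z : E.Letter) : Finset (E.Letter × E.Letter) := (block y z).erase (y, z)

lemma mem_block_edge_ghost {α β : S} {i : Fin (E.weight α)} {j : Fin (E.weight β)}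
    {w : E.Letter × E.Letter} :
    w ∈ block (.edge α i) (.ghost β j) ↔ α = β ∧ ∃ γ k l, w = (.edge γ k, .ghost γ l) ∧
      E.src γ = E.src α ∧ k.val = i.val ∧ l.val = j.val := by
  by_cases h : α = β
  · rw [block, if_pos h, Finset.mem_biUnion]
    simp only [mem_outEdges, h, true_and]
    constructor
    · rintro ⟨γ, hγ, hw⟩
      split_ifs at hw with hk
      · exact ⟨γ, _, _, Finset.mem_singleton.1 hw, hγ, rfl, rfl⟩
      · exact absurd hw (Finset.notMem_empty _)
    · rintro ⟨γ, k, l, rfl, hγ, hk, hl⟩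
      refine ⟨γ, hγ, ?_⟩
      simp [← hk, ← hl]
  · simp [block, h]

lemma mem_block_ghost_edge {α β : S} {i : Fin (E.weight α)} {j : Fin (E.weight β)}
    {w : E.Letter × E.Letter} :
    w ∈ block (.ghost α i) (.edge β j) ↔ i.val = j.val ∧ ∃ k l, w = (.ghost α k, .edge β l) ∧
      k.val = l.val := by
  by_cases h : i.val = j.val
  · rw [block, if_pos h, Finset.mem_biUnion]
    simp only [Finset.mem_range, h, true_and]
    constructor
    · rintro ⟨k, -, hw⟩
      split_ifs at hw with hk
      · exact ⟨_, _, Finset.mem_singleton.1 hw, rfl⟩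
      · exact absurd hw (Finset.notMem_empty _)
    · rintro ⟨k, l, rfl, hkl⟩
      refine ⟨k, lt_max_of_lt_left k.2, ?_⟩
      rw [dif_pos ⟨k.2, hkl ▸ l.2⟩, Finset.mem_singleton]
      exact Prod.ext rfl (congrArg (edge β) (Fin.ext hkl.symm))
  · simp [block, h]

lemma mem_block_cases {y z : E.Letter} {w : E.Letter × E.Letter} (h : w ∈ block y z) :
    (∃ α γ i j k l, y = .edge α i ∧ z = .ghost α j ∧ w = (.edge γ k, .ghost γ l) ∧
      E.src γ = E.src α ∧ k.val = i.val ∧ l.val = j.val) ∨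
    (∃ α β i j k l, y = .ghost α i ∧ z = .edge β j ∧ w = (.ghost α k, .edge β l) ∧
      i.val = j.val ∧ k.val = l.val) := by
  cases y with
  | vertex => simp [block] at h
  | edge α i =>
    cases z with
    | ghost β j =>
      obtain ⟨rfl, γ, k, l, hw⟩ := mem_block_edge_ghost.1 h
      exact .inl ⟨α, γ, i, j, k, l, rfl, rfl, hw⟩
    | _ => simp [block] at h
  | ghost α i =>
    cases z with
    | edge β j =>
      obtain ⟨hij, k, l, rfl, hkl⟩ := mem_block_ghost_edge.1 h
      exact .inr ⟨α, β, i, j, k, l, rfl, rfl, rfl, hij, hkl⟩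
    | _ => simp [block] at h

section

variable {y z t : E.Letter} {w : E.Letter × E.Letter}

lemma block_eq_of_mem (h : w ∈ block y z) : block w.1 w.2 = block y z := by
  obtain ⟨α, γ, i, j, k, l, rfl, rfl, rfl, h, hk, hl⟩ | ⟨α, β, i, j, k, l, rfl, rfl, rfl, hi, hk⟩ :=
    mem_block_cases h
  · ext w'
    simp [mem_block_edge_ghost, *]
  · ext w'
    simp [mem_block_ghost_edge, *]

lemma not_isVertex_left_of_mem_block (h : w ∈ block y z) : ¬ y.IsVertex := by
  rcases mem_block_cases h with h | h <;> grind [IsVertex]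

lemma not_isVertex_right_of_mem_block (h : w ∈ block y z) : ¬ z.IsVertex := by
  rcases mem_block_cases h with h | h <;> grind [IsVertex]

lemma src_eq_of_mem_block (h : w ∈ block y z) : w.1.src = y.src := by
  rcases mem_block_cases h with h | h <;> grind [src]

lemma tgt_eq_of_mem_block (h : w ∈ block y z) : w.2.tgt = z.tgt := by
  rcases mem_block_cases h with h | h <;> grind [tgt]

lemma tgt_eq_src_iff_of_mem_block (h : w ∈ block y z) :
    w.1.tgt = w.2.src ↔ y.tgt = z.src := by
  rcases mem_block_cases h with h | h <;> grind [tgt, src]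

lemma eq_of_mem_block_left {z' : E.Letter} (h : (y, z') ∈ block y z) : z' = z := by
  obtain ⟨α, γ, i, j, k, l, rfl, rfl, hw, -, -, hl⟩ | ⟨α, β, i, j, k, l, rfl, rfl, hw, hi, hk⟩ :=
    mem_block_cases h
  · obtain ⟨⟨⟩, rfl⟩ := Prod.mk.inj hw
    rw [Fin.ext hl]
  · obtain ⟨⟨⟩, rfl⟩ := Prod.mk.inj hw
    rw [Fin.ext (hk.symm.trans hi)]

lemma eq_of_mem_block_right {y' : E.Letter} (h : (y', z) ∈ block y z) : y' = y := by
  obtain ⟨α, γ, i, j, k, l, rfl, rfl, hw, -, hk, -⟩ | ⟨α, β, i, j, k, l, rfl, rfl, hw, hi, hk⟩ :=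
    mem_block_cases h
  · obtain ⟨rfl, ⟨⟩⟩ := Prod.mk.inj hw
    rw [Fin.ext hk]
  · obtain ⟨rfl, ⟨⟩⟩ := Prod.mk.inj hw
    rw [Fin.ext (hk.trans hi.symm)]

lemma IsRedex.mem_block (h : IsRedex c y z) : (y, z) ∈ block y z := by
  match y, z, h with
  | .edge _ i, .ghost _ j, ⟨rfl, _⟩ =>
    exact mem_block_edge_ghost.2 ⟨rfl, _, i, j, rfl, rfl, rfl, rfl⟩
  | .ghost _ i, .edge _ j, h =>
    have hij := h.1.trans h.2.symm
    exact mem_block_ghost_edge.2 ⟨hij, i, j, rfl, hij⟩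

lemma self_mem_block_of_mem (h : w ∈ block y z) : (y, z) ∈ block y z := by
  obtain ⟨α, γ, i, j, k, l, rfl, rfl, -⟩ | ⟨α, β, i, j, k, l, rfl, rfl, -, hij, -⟩ :=
    mem_block_cases h
  · exact mem_block_edge_ghost.2 ⟨rfl, _, i, j, rfl, rfl, rfl, rfl⟩
  · exact mem_block_ghost_edge.2 ⟨hij, i, j, rfl, hij⟩

lemma exists_isRedex_mem_block (c : E.SpecialEdges) (h : w ∈ block y z) :
    ∃ r ∈ block y z, IsRedex c r.1 r.2 := by
  obtain ⟨α, γ, i, j, k, l, rfl, rfl, rfl, -⟩ | ⟨α, β, i, j, k, l, rfl, rfl, rfl, hi, -⟩ :=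
    mem_block_cases h
  · obtain ⟨σ, hσ, hσα⟩ := c.exists_isSpecial ⟨α, rfl⟩
    have hασ := hσ.weight_le hσα.symm
    exact ⟨(.edge σ ⟨i, i.2.trans_le hασ⟩, .ghost σ ⟨j, j.2.trans_le hασ⟩),
      mem_block_edge_ghost.2 ⟨rfl, σ, _, _, rfl, hσα, rfl, rfl⟩, rfl, hσ⟩
  · exact ⟨(.ghost α ⟨0, E.weight_pos α⟩, .edge β ⟨0, E.weight_pos β⟩),
      mem_block_ghost_edge.2 ⟨hi, _, _, rfl, rfl⟩, rfl, rfl⟩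

lemma IsRedex.eq_of_mem_block (h : IsRedex c y z) (hw : w ∈ block y z)
    (hr : IsRedex c w.1 w.2) : w = (y, z) := by
  obtain ⟨α, γ, i, j, k, l, rfl, rfl, rfl, hγ, hk, hl⟩ | ⟨α, β, i, j, k, l, rfl, rfl, rfl, -⟩ :=
    mem_block_cases hw
  · obtain rfl := hr.2.eq_of_src_eq h.2 hγ
    rw [Fin.ext hk, Fin.ext hl]
  · rw [Fin.ext (hr.1.trans h.1.symm), Fin.ext (hr.2.trans h.2.symm)]

lemma isRedex_right_iff_of_mem_block (h : w ∈ block y z) :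
    IsRedex c w.2 t ↔ IsRedex c z t := by
  cases t <;> rcases mem_block_cases h with h | h <;> grind [IsRedex]

lemma isRedex_left_iff_of_mem_block (h : w ∈ block y z) :
    IsRedex c t w.1 ↔ IsRedex c t y := by
  cases t <;> rcases mem_block_cases h with h | h <;> grind [IsRedex]

lemma mem_block_star_iff {a : E.Letter} (h : y.tgt = z.src) (h' : z.tgt = t.src) :
    (a, t.star) ∈ block y z ↔ (y.star, a) ∈ block z t := by
  constructor
  · intro hw
    obtain ⟨α, γ, i, j, k, l, rfl, rfl, hw, -, hk, hl⟩ | ⟨α, β, i, j, k, l, rfl, rfl, hw, hi, hk⟩ :=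
      mem_block_cases hw
    · obtain ⟨rfl, ht⟩ := Prod.mk.inj hw
      obtain rfl : t = .edge γ l := by rw [← star_star t, ht]; rfl
      exact mem_block_ghost_edge.2 ⟨hl.symm, _, _, rfl, hk.symm⟩
    · obtain ⟨rfl, ht⟩ := Prod.mk.inj hw
      obtain rfl : t = .ghost β l := by rw [← star_star t, ht]; rfl
      exact mem_block_edge_ghost.2 ⟨rfl, _, _, _, rfl, h, hi, hk⟩
  · intro hw
    obtain ⟨α, γ, i, j, k, l, rfl, rfl, hw, -, hk, hl⟩ | ⟨α, β, i, j, k, l, rfl, rfl, hw, hi, hk⟩ :=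
      mem_block_cases hw
    · obtain ⟨ht, rfl⟩ := Prod.mk.inj hw
      obtain rfl : y = .ghost γ k := by rw [← star_star y, ht]; rfl
      exact mem_block_ghost_edge.2 ⟨hk, _, _, rfl, hl⟩
    · obtain ⟨ht, rfl⟩ := Prod.mk.inj hw
      obtain rfl : y = .edge α k := by rw [← star_star y, ht]; rfl
      exact mem_block_edge_ghost.2 ⟨rfl, _, _, _, rfl, h'.symm, hk.symm, hi.symm⟩

lemma exists_mem_block_left_of_right {a b b' d : E.Letter} (hyz : IsRedex c y z)
    (hzt : IsRedex c z t) (hab : (a, b) ∈ block y z) (hbd : (b', d) ∈ block b t) :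
    ∃ e, (e, d) ∈ block z t ∧ (a, b') ∈ block y e := by
  match y, z, t, hyz, hzt with
  | .edge σ i, .ghost _ j, .edge τ k, ⟨rfl, hσ⟩, _ =>
    obtain ⟨-, γ, i', j', hw, hγ, hi, hj⟩ := mem_block_edge_ghost.1 hab
    obtain ⟨rfl, rfl⟩ := Prod.mk.inj hw
    obtain ⟨hjk, l, m, hw, hlm⟩ := mem_block_ghost_edge.1 hbd
    obtain ⟨rfl, rfl⟩ := Prod.mk.inj hw
    exact ⟨.ghost σ ⟨l, l.2.trans_le (hσ.weight_le hγ)⟩,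
      mem_block_ghost_edge.2 ⟨hj.symm.trans hjk, _, _, rfl, hlm⟩,
      mem_block_edge_ghost.2 ⟨rfl, _, _, _, rfl, hγ, hi, rfl⟩⟩
  | .ghost α i, .edge σ j, .ghost _ k, hj, ⟨rfl, _⟩ =>
    obtain ⟨-, i', j', hw, hij'⟩ := mem_block_ghost_edge.1 hab
    obtain ⟨rfl, rfl⟩ := Prod.mk.inj hw
    obtain ⟨-, γ, l, m, hw, hγ, hl, hm⟩ := mem_block_edge_ghost.1 hbd
    obtain ⟨rfl, rfl⟩ := Prod.mk.inj hw
    exact ⟨.edge γ ⟨0, E.weight_pos γ⟩,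
      mem_block_edge_ghost.2 ⟨rfl, _, _, _, rfl, hγ, hj.2.symm, hm⟩,
      mem_block_ghost_edge.2 ⟨hj.1, _, _, rfl, hij'.trans hl.symm⟩⟩

lemma exists_mem_block_right_of_left {a b' d e : E.Letter} (hyz : IsRedex c y z)
    (hzt : IsRedex c z t) (hed : (e, d) ∈ block z t) (hab : (a, b') ∈ block y e) :
    ∃ b, (a, b) ∈ block y z ∧ (b', d) ∈ block b t := by
  match y, z, t, hyz, hzt with
  | .edge σ i, .ghost _ j, .edge τ k, ⟨rfl, _⟩, hj =>
    obtain ⟨-, l, m, hw, hlm⟩ := mem_block_ghost_edge.1 hed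
    obtain ⟨rfl, rfl⟩ := Prod.mk.inj hw
    obtain ⟨-, γ, i', l', hw, hγ, hi, hl⟩ := mem_block_edge_ghost.1 hab
    obtain ⟨rfl, rfl⟩ := Prod.mk.inj hw
    exact ⟨.ghost γ ⟨0, E.weight_pos γ⟩,
      mem_block_edge_ghost.2 ⟨rfl, _, _, _, rfl, hγ, hi, hj.1.symm⟩,
      mem_block_ghost_edge.2 ⟨hj.2.symm, _, _, rfl, hl.trans hlm⟩⟩
  | .ghost α i, .edge σ j, .ghost _ k, hij, ⟨rfl, hσ⟩ =>
    obtain ⟨-, γ, j', k', hw, hγ, -, hk⟩ := mem_block_edge_ghost.1 hed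
    obtain ⟨rfl, rfl⟩ := Prod.mk.inj hw
    obtain ⟨-, l, m, hw, hlm⟩ := mem_block_ghost_edge.1 hab
    obtain ⟨rfl, rfl⟩ := Prod.mk.inj hw
    exact ⟨.edge σ ⟨m, m.2.trans_le (hσ.weight_le hγ)⟩,
      mem_block_ghost_edge.2 ⟨hij.1.trans hij.2.symm, _, _, rfl, hlm⟩,
      mem_block_edge_ghost.2 ⟨rfl, _, _, _, rfl, hγ, rfl, hk⟩⟩

lemma mem_reducts_iff (h : IsRedex c y z) :
    w ∈ reducts y z ↔ w ∈ block y z ∧ ¬ IsRedex c w.1 w.2 := by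
  rw [reducts, Finset.mem_erase, and_comm]
  refine and_congr_right fun hw => not_congr ⟨?_, h.eq_of_mem_block hw⟩
  rintro rfl
  exact h

lemma IsRedex.sum_block {M : Type*} [AddCommMonoid M] (h : IsRedex c y z)
    (f : E.Letter × E.Letter → M) :
    ∑ w ∈ block y z, f w = f (y, z) + ∑ w ∈ reducts y z, f w :=
  (Finset.add_sum_erase _ _ h.mem_block).symm

lemma snd_eq_of_mem_block {a b b' : E.Letter} (h : (a, b) ∈ block y z)
    (h' : (a, b') ∈ block y z) : b = b' :=
  eq_of_mem_block_left (block_eq_of_mem h' ▸ h)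

lemma fst_eq_of_mem_block {a a' b : E.Letter} (h : (a, b) ∈ block y z)
    (hab : (a', b) ∈ block y z) : a = a' :=
  eq_of_mem_block_right (block_eq_of_mem hab ▸ h)

/-- The critical pair `y z t`: rewriting `y z` first and rewriting `z t` first agree. -/
lemma exists_mem_reducts_comm {a b' d : E.Letter} (hyz : IsRedex c y z) (hzt : IsRedex c z t) :
    (∃ b, (a, b) ∈ reducts y z ∧ (b', d) ∈ reducts b t) ↔
      ∃ e, (e, d) ∈ reducts z t ∧ (a, b') ∈ reducts y e := by
  constructor
  · rintro ⟨b, hab, hbd⟩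
    rw [mem_reducts_iff hyz] at hab
    rw [mem_reducts_iff ((isRedex_right_iff_of_mem_block hab.1).2 hzt)] at hbd
    obtain ⟨e, hed, hab'⟩ := exists_mem_block_left_of_right hyz hzt hab.1 hbd.1
    refine ⟨e, (mem_reducts_iff hzt).2 ⟨hed, ?_⟩,
      (mem_reducts_iff ((isRedex_left_iff_of_mem_block hed).2 hyz)).2 ⟨hab', ?_⟩⟩
    · exact (isRedex_right_iff_of_mem_block hab').not.1 hbd.2
    · exact (isRedex_left_iff_of_mem_block hbd.1).not.2 hab.2
  · rintro ⟨e, hed, hab⟩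
    rw [mem_reducts_iff hzt] at hed
    rw [mem_reducts_iff ((isRedex_left_iff_of_mem_block hed.1).2 hyz)] at hab
    obtain ⟨b, hab', hbd⟩ := exists_mem_block_right_of_left hyz hzt hed.1 hab.1
    refine ⟨b, (mem_reducts_iff hyz).2 ⟨hab', ?_⟩,
      (mem_reducts_iff ((isRedex_right_iff_of_mem_block hab').2 hzt)).2 ⟨hbd, ?_⟩⟩
    · exact (isRedex_left_iff_of_mem_block hbd).not.1 hab.2
    · exact (isRedex_right_iff_of_mem_block hab.1).not.2 hed.2

lemma sum_reducts_sum_reducts {M : Type*} [AddCommMonoid M] (hyz : IsRedex c y z)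
    (hzt : IsRedex c z t) (f : E.Letter → E.Letter → E.Letter → M) :
    ∑ w ∈ reducts y z, ∑ u ∈ reducts w.2 t, f w.1 u.1 u.2 =
      ∑ u ∈ reducts z t, ∑ w ∈ reducts y u.1, f w.1 w.2 u.2 := by
  let left : (_ : E.Letter × E.Letter) × E.Letter × E.Letter → E.Letter × E.Letter × E.Letter :=
    fun q => (q.1.1, q.2.1, q.2.2)
  let right : (_ : E.Letter × E.Letter) × E.Letter × E.Letter → E.Letter × E.Letter × E.Letter :=
    fun q => (q.2.1, q.2.2, q.1.2)
  have himage : ((reducts y z).sigma fun w => reducts w.2 t).image left =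
      ((reducts z t).sigma fun u => reducts y u.1).image right := by
    ext ⟨a, b', d⟩
    simpa [left, right, and_assoc] using exists_mem_reducts_comm hyz hzt
  rw [Finset.sum_sigma', Finset.sum_sigma']
  refine (Finset.sum_image (f := fun q => f q.1 q.2.1 q.2.2) (g := left) ?_).symm.trans
    ((Finset.sum_congr himage fun _ _ => rfl).trans (Finset.sum_image ?_))
  · rintro ⟨⟨a, e⟩, b, d⟩ h ⟨⟨a', e'⟩, b', d'⟩ h' heq
    obtain ⟨rfl, rfl, rfl⟩ : a = a' ∧ b = b' ∧ d = d' := by simpa [left] using heq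
    simp only [Finset.coe_sigma, Set.mem_sigma_iff, Finset.mem_coe] at h h'
    obtain rfl := snd_eq_of_mem_block (Finset.mem_of_mem_erase h.1) (Finset.mem_of_mem_erase h'.1)
    rfl
  · rintro ⟨⟨e, d⟩, a, b⟩ h ⟨⟨e', d'⟩, a', b'⟩ h' heq
    obtain ⟨rfl, rfl, rfl⟩ : a = a' ∧ b = b' ∧ d = d' := by simpa [right] using heq
    simp only [Finset.coe_sigma, Set.mem_sigma_iff, Finset.mem_coe] at h h'
    obtain rfl := fst_eq_of_mem_block (Finset.mem_of_mem_erase h.1) (Finset.mem_of_mem_erase h'.1)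
    rfl

lemma sum_block_ite_star {M : Type*} [AddCommMonoid M] (h : y.tgt = z.src)
    (h' : z.tgt = t.src) (f : E.Letter → M) :
    (∑ w ∈ block y z, if t = w.2.star then f w.1 else 0) =
      ∑ u ∈ block z t, if u.1 = y.star then f u.2 else 0 := by
  rw [← Finset.sum_filter, ← Finset.sum_filter]
  refine Finset.sum_bij' (fun w _ => (y.star, w.1)) (fun u _ => (u.2, t.star)) ?_ ?_ ?_ ?_ ?_
  · rintro ⟨a, b⟩ hw
    obtain ⟨hw, rfl⟩ := Finset.mem_filter.1 hw
    exact Finset.mem_filter.2 ⟨(mem_block_star_iff h h').1 (by rwa [star_star]), rfl⟩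
  · rintro ⟨a, b⟩ hu
    obtain ⟨hu, rfl⟩ := Finset.mem_filter.1 hu
    exact Finset.mem_filter.2 ⟨(mem_block_star_iff h h').2 hu, (star_star t).symm⟩
  · rintro ⟨a, b⟩ hw
    obtain ⟨-, rfl⟩ := Finset.mem_filter.1 hw
    rw [star_star]
  · rintro ⟨a, b⟩ hu
    obtain ⟨-, rfl⟩ := Finset.mem_filter.1 hu
    rfl
  · simp

lemma block_eq_empty_of_mem {y' z' : E.Letter} (h : (y', z') ∈ block y z)
    (hne : (y', z') ≠ (y, z)) : block y z' = ∅ := by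
  refine Finset.eq_empty_of_forall_notMem fun w hw => ?_
  match y, z, h, hw with
  | .edge α i, .ghost _ j, h, hw =>
    obtain ⟨rfl, γ, k, l, h, -, hk, hl⟩ := mem_block_edge_ghost.1 h
    obtain ⟨rfl, rfl⟩ := Prod.mk.inj h
    obtain ⟨rfl, -⟩ := mem_block_edge_ghost.1 hw
    exact hne (by rw [Fin.ext hk, Fin.ext hl])
  | .ghost α i, .edge β j, h, hw =>
    obtain ⟨hij, k, l, h, hkl⟩ := mem_block_ghost_edge.1 h
    obtain ⟨rfl, rfl⟩ := Prod.mk.inj h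
    obtain ⟨hil, -⟩ := mem_block_ghost_edge.1 hw
    exact hne (by rw [Fin.ext (hkl.trans hil.symm), Fin.ext (hil.symm.trans hij)])

lemma IsRedex.reducts_nonempty (hweight : ∀ α, 2 ≤ E.weight α)
    (hcard : ∀ x, E.NotSink x →
      2 ≤ ((E.outEdges x).filter fun α => E.weight α = E.vertexWeight x).card)
    (h : IsRedex c y z) : (reducts y z).Nonempty := by
  match y, z, h with
  | .edge α i, .ghost _ j, ⟨rfl, hα⟩ =>
    obtain ⟨γ, hγ, hne⟩ := Finset.exists_mem_ne (hcard _ ⟨α, rfl⟩) α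
    rw [Finset.mem_filter, mem_outEdges, ← hα.weight_eq] at hγ
    exact ⟨(.edge γ (i.cast hγ.2.symm), .ghost γ (j.cast hγ.2.symm)), Finset.mem_erase.2
      ⟨by simp [hne], mem_block_edge_ghost.2 ⟨rfl, γ, _, _, rfl, hγ.1, rfl, rfl⟩⟩⟩
  | .ghost α i, .edge β j, h =>
    exact ⟨(.ghost α ⟨1, hweight α⟩, .edge β ⟨1, hweight β⟩), Finset.mem_erase.2
      ⟨by simp [Fin.ext_iff, h.1], mem_block_ghost_edge.2 ⟨h.1.trans h.2.symm, _, _, rfl, rfl⟩⟩⟩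

end

end Letter

open Letter

/-! ### Multiplication of normal paths by a letter -/

/-- A generalised path is encoded as the list `l` of its edges and ghost edges together with its
range `x`, so that the vertex `x` is the path `([], x)`. This is the source of `(l, x)`. -/
def pathSrc : List E.Letter → V → V
  | [], x => x
  | y :: _, _ => y.src

/-- `(l, x)` is a generalised path with no redex among its pairs of consecutive letters. -/
def IsNormalPath (c : E.SpecialEdges) : List E.Letter → V → Prop
  | [], _ => True
  | y :: l, x => ¬ y.IsVertex ∧ y.tgt = pathSrc l x ∧ (∀ z ∈ l.head?, ¬ IsRedex c y z) ∧
      IsNormalPath c l x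

lemma isNormalPath_cons {y : E.Letter} {l : List E.Letter} {x : V} :
    IsNormalPath c (y :: l) x ↔ ¬ y.IsVertex ∧ y.tgt = pathSrc l x ∧
      (∀ z ∈ l.head?, ¬ IsRedex c y z) ∧ IsNormalPath c l x :=
  Iff.rfl

lemma IsNormalPath.tail {y : E.Letter} {l : List E.Letter} {x : V}
    (h : IsNormalPath c (y :: l) x) : IsNormalPath c l x :=
  h.2.2.2

lemma IsNormalPath.cons_or_exists_isRedex {y : E.Letter} {l : List E.Letter} {x : V}
    (h : IsNormalPath c l x) (hy : ¬ y.IsVertex) (htgt : y.tgt = pathSrc l x) :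
    IsNormalPath c (y :: l) x ∨ ∃ z l', l = z :: l' ∧ IsRedex c y z := by
  by_contra! hred
  refine hred.1 ⟨hy, htgt, fun z hz => ?_, h⟩
  obtain ⟨l', rfl⟩ := List.head?_eq_some_iff.1 hz
  exact hred.2 z l' rfl

lemma IsNormalPath.reduct {y z : E.Letter} {w : E.Letter × E.Letter} {l : List E.Letter} {x : V}
    (h : IsNormalPath c (z :: l) x) (hyz : IsRedex c y z) (hcomp : y.tgt = z.src)
    (hw : w ∈ reducts y z) : IsNormalPath c (w.1 :: w.2 :: l) x := by
  obtain ⟨-, hz, hred, hl⟩ := isNormalPath_cons.1 h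
  obtain ⟨hw, hnot⟩ := (mem_reducts_iff hyz).1 hw
  have hww : w ∈ block w.1 w.2 := (block_eq_of_mem hw).symm ▸ hw
  refine ⟨not_isVertex_left_of_mem_block hww, (tgt_eq_src_iff_of_mem_block hw).2 hcomp, ?_,
    not_isVertex_right_of_mem_block hww, (tgt_eq_of_mem_block hw).trans hz, ?_, hl⟩
  · simpa using hnot
  · exact fun t ht => (isRedex_right_iff_of_mem_block hw).not.2 (hred t ht)

variable (E) in
/-- The free left `R`-module on all pairs `(l, x)`; the weighted Leavitt path algebra acts on its
submodule spanned by the normal paths. -/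
abbrev PathModule (R : Type w) [Ring R] := List E.Letter × V →₀ R

section

variable (R : Type w) [Ring R]

/-- The basis vector of the path module given by `(l, x)`. -/
def pathElt (l : List E.Letter) (x : V) : E.PathModule R := Finsupp.single (l, x) 1

/-- The normal form of the product of a letter and a normal path. -/
def letterMulPath (c : E.SpecialEdges) (y : E.Letter) (l : List E.Letter) (x : V) :
    E.PathModule R :=
  if y.tgt ≠ pathSrc l x then 0
  else if y.IsVertex then pathElt R l x
  else match l with
    | [] => pathElt R [y] x
    | z :: l =>
      if IsRedex c y z then
        (if z = y.star then pathElt R l x else 0) - ∑ w ∈ reducts y z, pathElt R (w.1 :: w.2 :: l) x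
      else pathElt R (y :: z :: l) x

/-- The linear extension of the left multiplication of normal paths by a letter. -/
def letterEnd (c : E.SpecialEdges) (y : E.Letter) : E.PathModule R →ₗ[R] E.PathModule R :=
  Finsupp.linearCombination R fun p => letterMulPath R c y p.1 p.2

end

variable {R : Type w} [Ring R]

section

variable {y z : E.Letter} {l : List E.Letter} {x : V}

lemma letterEnd_pathElt : letterEnd R c y (pathElt R l x) = letterMulPath R c y l x := by
  simp [letterEnd, pathElt]

lemma letterEnd_pathElt_of_tgt_ne (h : y.tgt ≠ pathSrc l x) :
    letterEnd R c y (pathElt R l x) = 0 := by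
  rw [letterEnd_pathElt, letterMulPath.eq_def, if_pos h]

lemma letterEnd_vertex_pathElt (v : V) :
    letterEnd R c (.vertex v) (pathElt R l x) = if v = pathSrc l x then pathElt R l x else 0 := by
  have hv : (Letter.vertex v : E.Letter).IsVertex := ⟨v, rfl⟩
  simp [letterEnd_pathElt, letterMulPath.eq_def, hv, show (vertex v : E.Letter).tgt = v from rfl]

lemma letterEnd_pathElt_of_isNormalPath (h : IsNormalPath c (y :: l) x) :
    letterEnd R c y (pathElt R l x) = pathElt R (y :: l) x := by
  obtain ⟨hy, htgt, hred, -⟩ := isNormalPath_cons.1 h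
  rw [letterEnd_pathElt, letterMulPath.eq_def, if_neg (not_not.2 htgt), if_neg hy]
  cases l with
  | nil => rfl
  | cons z l => exact if_neg (hred z rfl)

lemma letterEnd_pathElt_of_isRedex (hyz : IsRedex c y z)
    (hcomp : y.tgt = pathSrc (z :: l) x) :
    letterEnd R c y (pathElt R (z :: l) x) = (if z = y.star then pathElt R l x else 0) -
      ∑ w ∈ reducts y z, pathElt R (w.1 :: w.2 :: l) x := by
  rw [letterEnd_pathElt, letterMulPath.eq_def, if_neg (not_not.2 hcomp),
    if_neg (not_isVertex_left_of_mem_block hyz.mem_block)]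
  exact if_pos hyz

variable (R) in
/-- The span of the normal paths of length at most `k`. -/
def normalPaths (c : E.SpecialEdges) (k : ℕ∞) : Submodule R (E.PathModule R) :=
  Finsupp.supported R R {p | IsNormalPath c p.1 p.2 ∧ p.1.length ≤ k}

variable (R) in
/-- The span of the paths with source `v`. -/
def pathsFrom (v : V) : Submodule R (E.PathModule R) :=
  Finsupp.supported R R {p | pathSrc p.1 p.2 = v}

lemma pathElt_mem_normalPaths {k : ℕ∞} (h : IsNormalPath c l x) (hk : l.length ≤ k) :
    pathElt R l x ∈ normalPaths R c k :=
  Finsupp.single_mem_supported R 1 ⟨h, hk⟩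

lemma pathElt_mem_pathsFrom {v : V} (h : pathSrc l x = v) : pathElt R l x ∈ pathsFrom R v :=
  Finsupp.single_mem_supported R 1 h

lemma letterEnd_pathElt_mem (y : E.Letter) (h : IsNormalPath c l x) :
    letterEnd R c y (pathElt R l x) ∈ normalPaths R c (l.length + 1) ⊓ pathsFrom R y.src := by
  by_cases htgt : y.tgt = pathSrc l x
  swap
  · rw [letterEnd_pathElt_of_tgt_ne htgt]
    exact zero_mem _
  by_cases hy : y.IsVertex
  · obtain ⟨v, rfl⟩ := hy
    rw [letterEnd_vertex_pathElt, if_pos (show v = pathSrc l x from htgt)]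
    exact ⟨pathElt_mem_normalPaths h le_self_add, pathElt_mem_pathsFrom htgt.symm⟩
  obtain hyl | ⟨z, l, rfl, hyz⟩ := h.cons_or_exists_isRedex hy htgt
  · rw [letterEnd_pathElt_of_isNormalPath hyl]
    exact ⟨pathElt_mem_normalPaths hyl (by simp), pathElt_mem_pathsFrom rfl⟩
  rw [letterEnd_pathElt_of_isRedex hyz htgt]
  refine sub_mem ?_ (sum_mem fun w hw => ?_)
  · split_ifs with hstar
    · obtain ⟨-, hz', -, hl⟩ := isNormalPath_cons.1 h
      refine ⟨pathElt_mem_normalPaths hl ?_, pathElt_mem_pathsFrom (by rw [← hz', hstar, tgt_star])⟩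
      exact_mod_cast (by simp only [List.length_cons]; omega : l.length ≤ (z :: l).length + 1)
    · exact zero_mem _
  · exact ⟨pathElt_mem_normalPaths (h.reduct hyz htgt hw) (by simp),
      pathElt_mem_pathsFrom (src_eq_of_mem_block (Finset.mem_of_mem_erase hw))⟩

lemma supported_le_of_pathElt_mem {s : Set (List E.Letter × V)} {N : Submodule R (E.PathModule R)}
    (h : ∀ p ∈ s, pathElt R p.1 p.2 ∈ N) : Finsupp.supported R R s ≤ N := by
  rw [Finsupp.supported_eq_span_single, Submodule.span_le]
  rintro - ⟨p, hp, rfl⟩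
  exact h p hp

lemma letterEnd_eq_zero_of_tgt_ne {v : V} (h : y.tgt ≠ v) {n : E.PathModule R}
    (hn : n ∈ pathsFrom R v) : letterEnd R c y n = 0 := by
  have hle : pathsFrom R v ≤ LinearMap.ker (letterEnd R c y) :=
    supported_le_of_pathElt_mem fun p hp =>
      letterEnd_pathElt_of_tgt_ne (ne_of_ne_of_eq h (Eq.symm hp))
  exact hle hn

lemma letterEnd_vertex_of_mem_pathsFrom {v : V} {n : E.PathModule R} (hn : n ∈ pathsFrom R v) :
    letterEnd R c (.vertex v) n = n := by
  have hle : pathsFrom R v ≤ LinearMap.eqLocus (letterEnd R c (.vertex v)) LinearMap.id :=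
    supported_le_of_pathElt_mem fun p hp =>
      (letterEnd_vertex_pathElt v).trans (if_pos (Eq.symm hp))
  exact hle hn

lemma letterEnd_mem_normalPaths {k : ℕ∞} {n : E.PathModule R} (hn : n ∈ normalPaths R c k) :
    letterEnd R c y n ∈ normalPaths R c (k + 1) := by
  have hle : normalPaths R c k ≤ (normalPaths R c (k + 1)).comap (letterEnd R c y) :=
    supported_le_of_pathElt_mem fun p hp => by
      refine Finsupp.supported_mono ?_ (letterEnd_pathElt_mem y hp.1).1
      exact fun q hq => ⟨hq.1, hq.2.trans (add_le_add_left hp.2 1)⟩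
  exact hle hn

lemma letterEnd_mem_pathsFrom {n : E.PathModule R} (hn : n ∈ normalPaths R c ⊤) :
    letterEnd R c y n ∈ pathsFrom R y.src := by
  have hle : normalPaths R c ⊤ ≤ (pathsFrom R y.src).comap (letterEnd R c y) :=
    supported_le_of_pathElt_mem fun p hp => (letterEnd_pathElt_mem y hp.1).2
  exact hle hn

lemma sum_block_letterEnd_of_isNormalPath (hyz : IsRedex c y z) (hcomp : y.tgt = z.src)
    (h : IsNormalPath c (z :: l) x) :
    ∑ w ∈ block y z, letterEnd R c w.1 (letterEnd R c w.2 (pathElt R l x)) =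
      if z = y.star then pathElt R l x else 0 := by
  have hreducts : ∀ w ∈ reducts y z, letterEnd R c w.1 (letterEnd R c w.2 (pathElt R l x)) =
      pathElt R (w.1 :: w.2 :: l) x := fun w hw => by
    have hw' := h.reduct hyz hcomp hw
    rw [letterEnd_pathElt_of_isNormalPath hw'.tail, letterEnd_pathElt_of_isNormalPath hw']
  rw [hyz.sum_block, Finset.sum_congr rfl hreducts, letterEnd_pathElt_of_isNormalPath h,
    letterEnd_pathElt_of_isRedex hyz hcomp, sub_add_cancel]

section

variable {t : E.Letter}

lemma letterEnd_reduct_overlap (hyz : IsRedex c y z) (hcomp : y.tgt = z.src) (hzt : IsRedex c z t)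
    (hcomp' : z.tgt = t.src) (h : IsNormalPath c (t :: l) x) {w : E.Letter × E.Letter}
    (hw : w ∈ reducts y z) :
    letterEnd R c w.1 (letterEnd R c w.2 (pathElt R (t :: l) x)) =
      (if t = w.2.star then letterEnd R c w.1 (pathElt R l x) else 0) -
        ∑ u ∈ reducts w.2 t, pathElt R (w.1 :: u.1 :: u.2 :: l) x := by
  obtain ⟨hwb, hwr⟩ := (mem_reducts_iff hyz).1 hw
  have hwt : IsRedex c w.2 t := (isRedex_right_iff_of_mem_block hwb).2 hzt
  have hwcomp : w.2.tgt = t.src := (tgt_eq_of_mem_block hwb).trans hcomp'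
  have hww : w ∈ block w.1 w.2 := (block_eq_of_mem hwb).symm ▸ hwb
  rw [letterEnd_pathElt_of_isRedex hwt hwcomp, map_sub, map_sum, apply_ite (letterEnd R c w.1),
    map_zero]
  congr 1
  refine Finset.sum_congr rfl fun u hu => letterEnd_pathElt_of_isNormalPath ?_
  have hub := Finset.mem_of_mem_erase hu
  refine ⟨not_isVertex_left_of_mem_block hww, ?_, ?_, h.reduct hwt hwcomp hu⟩
  · exact ((tgt_eq_src_iff_of_mem_block hwb).2 hcomp).trans (src_eq_of_mem_block hub).symm
  · simpa [isRedex_left_iff_of_mem_block hub] using hwr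

lemma letterEnd_letterEnd_overlap (hyz : IsRedex c y z) (hcomp : y.tgt = z.src)
    (hzt : IsRedex c z t) (hcomp' : z.tgt = t.src) :
    letterEnd R c y (letterEnd R c z (pathElt R (t :: l) x)) =
      (if t = z.star then letterEnd R c y (pathElt R l x) else 0) -
        ∑ u ∈ reducts z t, ((if u.1 = y.star then pathElt R (u.2 :: l) x else 0) -
          ∑ w ∈ reducts y u.1, pathElt R (w.1 :: w.2 :: u.2 :: l) x) := by
  rw [letterEnd_pathElt_of_isRedex hzt hcomp', map_sub, map_sum, apply_ite (letterEnd R c y),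
    map_zero]
  congr 1
  refine Finset.sum_congr rfl fun u hu => letterEnd_pathElt_of_isRedex ?_ ?_
  · exact (isRedex_left_iff_of_mem_block (Finset.mem_of_mem_erase hu)).2 hyz
  · exact hcomp.trans (src_eq_of_mem_block (Finset.mem_of_mem_erase hu)).symm

lemma sum_block_letterEnd_of_overlap (hyz : IsRedex c y z) (hcomp : y.tgt = z.src)
    (hzt : IsRedex c z t) (hcomp' : z.tgt = t.src) (h : IsNormalPath c (t :: l) x) :
    ∑ w ∈ block y z, letterEnd R c w.1 (letterEnd R c w.2 (pathElt R (t :: l) x)) =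
      if z = y.star then pathElt R (t :: l) x else 0 := by
  have hlow : (∑ w ∈ block y z, if t = w.2.star then letterEnd R c w.1 (pathElt R l x) else 0) =
      (if z = y.star then pathElt R (t :: l) x else 0) +
        ∑ u ∈ reducts z t, if u.1 = y.star then pathElt R (u.2 :: l) x else 0 := by
    rw [sum_block_ite_star hcomp hcomp' fun a => letterEnd R c a (pathElt R l x), hzt.sum_block,
      letterEnd_pathElt_of_isNormalPath h]
    congr 1
    refine Finset.sum_congr rfl fun u hu => ?_
    rw [letterEnd_pathElt_of_isNormalPath (h.reduct hzt hcomp' hu).tail]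
  rw [hyz.sum_block] at hlow ⊢
  rw [letterEnd_letterEnd_overlap hyz hcomp hzt hcomp',
    Finset.sum_congr rfl fun w hw => letterEnd_reduct_overlap hyz hcomp hzt hcomp' h hw,
    Finset.sum_sub_distrib, Finset.sum_sub_distrib,
    sum_reducts_sum_reducts hyz hzt fun a b d => pathElt R (a :: b :: d :: l) x]
  refine Eq.trans ?_ (sub_eq_of_eq_add hlow)
  abel

end

lemma sum_block_letterEnd_pathElt (hyz : IsRedex c y z) (h : IsNormalPath c l x) :
    ∑ w ∈ block y z, letterEnd R c w.1 (letterEnd R c w.2 (pathElt R l x)) =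
      if z = y.star then letterEnd R c (.vertex y.src) (pathElt R l x) else 0 := by
  by_cases hl : z.tgt = pathSrc l x
  swap
  · rw [letterEnd_vertex_pathElt]
    rw [Finset.sum_eq_zero fun w hw => ?_, eq_comm]
    · split_ifs with hz hv
      · exact absurd (by rw [hz, tgt_star, hv]) hl
      all_goals rfl
    · rw [letterEnd_pathElt_of_tgt_ne (tgt_eq_of_mem_block hw ▸ hl), map_zero]
  by_cases hcomp : y.tgt = z.src
  swap
  · rw [if_neg (by rintro rfl; exact hcomp (src_star y).symm)]
    exact Finset.sum_eq_zero fun w hw => letterEnd_eq_zero_of_tgt_ne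
      ((tgt_eq_src_iff_of_mem_block hw).not.2 hcomp) (letterEnd_pathElt_mem _ h).2
  have hvertex : (if z = y.star then letterEnd R c (.vertex y.src) (pathElt R l x) else 0) =
      if z = y.star then pathElt R l x else 0 := by
    refine if_ctx_congr Iff.rfl (fun hz => ?_) fun _ => rfl
    rw [letterEnd_vertex_pathElt, if_pos (by rw [← hl, hz, tgt_star])]
  rw [hvertex]
  obtain hzl | ⟨t, l, rfl, hzt⟩ :=
    h.cons_or_exists_isRedex (not_isVertex_right_of_mem_block hyz.mem_block) hl
  · exact sum_block_letterEnd_of_isNormalPath hyz hcomp hzl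
  · exact sum_block_letterEnd_of_overlap hyz hcomp hzt hl h

lemma sum_block_letterEnd (hyz : IsRedex c y z) {n : E.PathModule R} (hn : n ∈ normalPaths R c ⊤) :
    ∑ w ∈ block y z, letterEnd R c w.1 (letterEnd R c w.2 n) =
      if z = y.star then letterEnd R c (.vertex y.src) n else 0 := by
  have hle : normalPaths R c ⊤ ≤ LinearMap.eqLocus
      (∑ w ∈ block y z, letterEnd R c w.1 ∘ₗ letterEnd R c w.2)
      (if z = y.star then letterEnd R c (.vertex y.src) else 0) :=
    supported_le_of_pathElt_mem fun p hp => by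
      have := sum_block_letterEnd_pathElt (R := R) hyz hp.1
      split_ifs at this ⊢ <;> simpa [LinearMap.mem_eqLocus]
  have := hle hn
  split_ifs at this ⊢ <;> simpa [LinearMap.mem_eqLocus]

end

/-! ### The action of the free ring -/

variable (R) in
/-- A letter as an element of the free `R`-ring. -/
def letterElt (y : E.Letter) : E.FreeRing R := E.word R (FreeSemigroup.of y)

lemma sum_block_edge_ghost (α : S) (i j : Fin (E.weight α)) :
    ∑ w ∈ block (.edge α i) (.ghost α j), letterElt R w.1 * letterElt R w.2 =
      ∑ γ ∈ E.outEdges (E.src α), E.edgeElt R γ i * E.ghostElt R γ j := by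
  rw [block, if_pos rfl, Finset.sum_biUnion]
  · refine Finset.sum_congr rfl fun γ _ => ?_
    by_cases h : i < E.weight γ ∧ j < E.weight γ
    · rw [dif_pos h, Finset.sum_singleton, edgeElt, dif_pos h.1, ghostElt, dif_pos h.2]
      rfl
    · rw [dif_neg h, Finset.sum_empty, edgeElt, ghostElt]
      split_ifs with hi hj
      · exact absurd ⟨hi, hj⟩ h
      all_goals simp
  · intro γ _ δ _ hne
    refine Finset.disjoint_left.2 fun w hγ hδ => hne ?_
    dsimp only at hγ hδ
    split_ifs at hγ hδ
    all_goals simp_all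

lemma sum_block_ghost_edge {α β : S} {i : Fin (E.weight α)} {j : Fin (E.weight β)}
    (hij : i.val = j.val) :
    ∑ w ∈ block (.ghost α i) (.edge β j), letterElt R w.1 * letterElt R w.2 =
      ∑ k ∈ Finset.range (max (E.weight α) (E.weight β)),
        E.ghostElt R α k * E.edgeElt R β k := by
  rw [block, if_pos hij, Finset.sum_biUnion]
  · refine Finset.sum_congr rfl fun k _ => ?_
    by_cases h : k < E.weight α ∧ k < E.weight β
    · rw [dif_pos h, Finset.sum_singleton, edgeElt, dif_pos h.2, ghostElt, dif_pos h.1]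
      rfl
    · rw [dif_neg h, Finset.sum_empty, edgeElt, ghostElt]
      split_ifs with hi hj
      · exact absurd ⟨hi, hj⟩ h
      all_goals simp
  · intro k _ l _ hne
    refine Finset.disjoint_left.2 fun w hk hl => hne ?_
    dsimp only at hk hl
    split_ifs at hk hl
    all_goals simp_all

lemma ghost_eq_star_edge_iff {α : S} {i j : Fin (E.weight α)} :
    (ghost α j : E.Letter) = (edge α i).star ↔ i.val = j.val := by
  simp [Letter.star, Fin.ext_iff, eq_comm]

lemma edge_zero_eq_star_ghost_zero_iff {α β : S} :
    (edge β ⟨0, E.weight_pos β⟩ : E.Letter) = (ghost α ⟨0, E.weight_pos α⟩).star ↔ α = β := by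
  constructor
  · rintro ⟨⟩
    rfl
  · rintro rfl
    rfl

lemma Letter.IsRedex.rel_sum_block {y z : E.Letter} (h : IsRedex c y z) :
    E.Rel R (∑ w ∈ block y z, letterElt R w.1 * letterElt R w.2)
      (if z = y.star then letterElt R (.vertex y.src) else 0) := by
  match y, z, h with
  | .edge α i, .ghost _ j, ⟨rfl, hα⟩ =>
    rw [sum_block_edge_ghost]
    simp only [ghost_eq_star_edge_iff]
    exact Rel.sum_edge_mul_ghost (E.src α) i j (i.2.trans_eq hα.weight_eq)
      (j.2.trans_eq hα.weight_eq)
  | .ghost α i, .edge β j, h =>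
    rw [sum_block_ghost_edge (h.1.trans h.2.symm)]
    obtain rfl : i = ⟨0, E.weight_pos α⟩ := Fin.ext h.1
    obtain rfl : j = ⟨0, E.weight_pos β⟩ := Fin.ext h.2
    simp only [edge_zero_eq_star_ghost_zero_iff]
    exact Rel.sum_ghost_mul_edge α β

section

variable (R)

/-- The action of a word on the path module, by successive multiplication by its letters. -/
def wordEnd (c : E.SpecialEdges) : E.Word →ₙ* Module.End R (E.PathModule R) :=
  FreeSemigroup.lift (letterEnd R c)

/-- The map `a ↦ a • n`, for the action of the free `R`-ring on the path module. -/
def act (c : E.SpecialEdges) (n : E.PathModule R) : E.FreeRing R →ₗ[R] E.PathModule R :=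
  Finsupp.linearCombination R (fun p => wordEnd R c p n) ∘ₗ
    (MonoidAlgebra.coeffLinearEquiv R).toLinearMap

end

lemma act_single (p : E.Word) (r : R) (n : E.PathModule R) :
    act R c n (MonoidAlgebra.single p r) = r • wordEnd R c p n :=
  Finsupp.linearCombination_single R r p

lemma act_letterElt (y : E.Letter) (n : E.PathModule R) :
    act R c n (letterElt R y) = letterEnd R c y n :=
  (act_single _ _ n).trans (one_smul R _)

lemma act_mul (a b : E.FreeRing R) (n : E.PathModule R) :
    act R c n (a * b) = act R c (act R c n b) a := by
  induction a using MonoidAlgebra.induction_linear with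
  | zero => simp
  | add a a' ha ha' => rw [add_mul, map_add, map_add, ha, ha']
  | single p r =>
    induction b using MonoidAlgebra.induction_linear with
    | zero => simp [act_single]
    | add b b' hb hb' => simp only [mul_add, map_add, hb, hb', act_single, smul_add]
    | single q s => simp [act_single, mul_smul]

lemma act_op_smul (r : R) (a : E.FreeRing R) (n : E.PathModule R) :
    act R c n (MulOpposite.op r • a) = act R c (r • n) a := by
  induction a using MonoidAlgebra.induction_linear with
  | zero => simp
  | add a b ha hb => rw [smul_add, map_add, map_add, ha, hb]
  | single p s => simp [act_single, mul_smul]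

lemma act_mem_normalPaths (a : E.FreeRing R) {n : E.PathModule R} (hn : n ∈ normalPaths R c ⊤) :
    act R c n a ∈ normalPaths R c ⊤ := by
  induction a using MonoidAlgebra.induction_linear with
  | zero => simp
  | add a b ha hb => simpa using add_mem ha hb
  | single p s =>
    rw [act_single]
    refine Submodule.smul_mem _ _ ?_
    induction p using FreeSemigroup.recOnMul with
    | ih1 y => exact letterEnd_mem_normalPaths hn
    | ih2 y p _ hp =>
      rw [map_mul]
      exact letterEnd_mem_normalPaths hp

lemma letterEnd_letterEnd_vertex_tgt (y : E.Letter) (n : E.PathModule R) :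
    letterEnd R c y (letterEnd R c (.vertex y.tgt) n) = letterEnd R c y n := by
  suffices letterEnd R c y ∘ₗ letterEnd R c (.vertex y.tgt) = letterEnd R c y from
    LinearMap.congr_fun this n
  refine Finsupp.lhom_ext' fun p => LinearMap.ext_ring ?_
  change letterEnd R c y (letterEnd R c _ (pathElt R p.1 p.2)) = letterEnd R c y (pathElt R p.1 p.2)
  rw [letterEnd_vertex_pathElt]
  split_ifs with h
  · rfl
  · rw [letterEnd_pathElt_of_tgt_ne h, map_zero]

lemma act_letterElt_mul_tgt (y : E.Letter) (n : E.PathModule R) :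
    act R c n (letterElt R y * letterElt R (.vertex y.tgt)) = act R c n (letterElt R y) := by
  simp only [act_mul, act_letterElt, letterEnd_letterEnd_vertex_tgt]

section

variable {n : E.PathModule R} (hn : n ∈ normalPaths R c ⊤)
include hn

lemma act_sum_block {y z : E.Letter} (hyz : IsRedex c y z) :
    act R c n (∑ w ∈ block y z, letterElt R w.1 * letterElt R w.2) =
      act R c n (if z = y.star then letterElt R (.vertex y.src) else 0) := by
  simp only [map_sum, act_mul, act_letterElt, sum_block_letterEnd hyz hn]
  rw [apply_ite (act R c n), act_letterElt, map_zero]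

lemma act_letterElt_src_mul (y : E.Letter) :
    act R c n (letterElt R (.vertex y.src) * letterElt R y) = act R c n (letterElt R y) := by
  simp only [act_mul, act_letterElt]
  exact letterEnd_vertex_of_mem_pathsFrom (letterEnd_mem_pathsFrom hn)

lemma act_eq_of_rel {a b : E.FreeRing R} (h : E.Rel R a b) : act R c n a = act R c n b := by
  cases h with
  | vertex_mul x y =>
    split_ifs with hxy
    · subst hxy
      exact act_letterElt_src_mul hn (.vertex x)
    · change act R c n (letterElt R _ * letterElt R _) = _
      rw [act_mul, act_letterElt, act_letterElt, map_zero]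
      exact letterEnd_eq_zero_of_tgt_ne (y := .vertex x) hxy (letterEnd_mem_pathsFrom hn)
  | src_mul_edge α i hi =>
    rw [edgeElt, dif_pos hi]
    exact act_letterElt_src_mul hn (.edge α ⟨i, hi⟩)
  | edge_mul_tgt α i hi =>
    rw [edgeElt, dif_pos hi]
    exact act_letterElt_mul_tgt (.edge α ⟨i, hi⟩) n
  | tgt_mul_ghost α i hi =>
    rw [ghostElt, dif_pos hi]
    exact act_letterElt_src_mul hn (.ghost α ⟨i, hi⟩)
  | ghost_mul_src α i hi =>
    rw [ghostElt, dif_pos hi]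
    exact act_letterElt_mul_tgt (.ghost α ⟨i, hi⟩) n
  | sum_edge_mul_ghost x i j hi hj =>
    obtain ⟨α, hα, rfl⟩ := c.exists_isSpecial (notSink_of_lt_vertexWeight hi)
    rw [← hα.weight_eq] at hi hj
    have hyz : IsRedex c (.edge α ⟨i, hi⟩) (.ghost α ⟨j, hj⟩) := ⟨rfl, hα⟩
    rw [← sum_block_edge_ghost α ⟨i, hi⟩ ⟨j, hj⟩, act_sum_block hn hyz]
    simp only [ghost_eq_star_edge_iff]
    rfl
  | sum_ghost_mul_edge α β =>
    have hyz : IsRedex c (.ghost α ⟨0, E.weight_pos α⟩) (.edge β ⟨0, E.weight_pos β⟩) := ⟨rfl, rfl⟩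
    rw [← sum_block_ghost_edge (i := ⟨0, E.weight_pos α⟩) (j := ⟨0, E.weight_pos β⟩) rfl,
      act_sum_block hn hyz]
    simp only [edge_zero_eq_star_ghost_zero_iff]
    rfl

end

variable (R) in
/-- The elements of the free `R`-ring that annihilate the normal paths. -/
def annihilator (c : E.SpecialEdges) : TwoSidedIdeal (E.FreeRing R) :=
  TwoSidedIdeal.mk' {a | ∀ n ∈ normalPaths R c ⊤, act R c n a = 0}
    (fun _ _ => map_zero _)
    (fun ha hb n hn => by rw [map_add, ha n hn, hb n hn, add_zero])
    (fun ha n hn => by rw [map_neg, ha n hn, neg_zero])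
    (fun {a b} hb n hn => by
      rw [act_mul, hb n hn]
      simpa using (act_op_smul (c := c) 0 a 0).symm)
    (fun {a b} ha n hn => by rw [act_mul, ha _ (act_mem_normalPaths b hn)])

lemma mem_annihilator {a : E.FreeRing R} :
    a ∈ annihilator R c ↔ ∀ n ∈ normalPaths R c ⊤, act R c n a = 0 := by
  simp [annihilator, TwoSidedIdeal.mem_mk']

lemma relIdeal_le_annihilator (c : E.SpecialEdges) : E.relIdeal R ≤ annihilator R c := by
  refine sInf_le ⟨fun r a ha => ?_, fun a b hab => mem_annihilator.2 fun n hn => ?_⟩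
  · rw [mem_annihilator] at ha
    refine ⟨mem_annihilator.2 fun n hn => ?_, mem_annihilator.2 fun n hn => ?_⟩
    · rw [map_smul, ha n hn, smul_zero]
    · rw [act_op_smul, ha _ (Submodule.smul_mem _ _ hn)]
  · rw [map_sub, act_eq_of_rel hn hab, sub_self]

/-! ### Linear combinations of normal paths in the weighted Leavitt path algebra -/

lemma sub_mem_relIdeal {a b : E.FreeRing R} (h : E.Rel R a b) : a - b ∈ E.relIdeal R :=
  (TwoSidedIdeal.mem_sInf _).2 fun _ hJ => hJ.2 a b h

lemma smul_mem_relIdeal (r : R) {a : E.FreeRing R} (h : a ∈ E.relIdeal R) :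
    r • a ∈ E.relIdeal R :=
  (TwoSidedIdeal.mem_sInf _).2 fun _ hJ => (hJ.1 r a ((TwoSidedIdeal.mem_sInf _).1 h _ hJ)).1

lemma toLPA_eq_iff {a b : E.FreeRing R} : E.toLPA R a = E.toLPA R b ↔ a - b ∈ E.relIdeal R :=
  (RingCon.eq _).trans (TwoSidedIdeal.rel_iff _ _ _)

variable (E R) in
/-- The quotient map onto the weighted Leavitt path algebra as a homomorphism. -/
def toLPAHom : E.FreeRing R →ₙ+* E.LPA R where
  toFun := E.toLPA R
  map_mul' _ _ := rfl
  map_zero' := rfl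
  map_add' _ _ := rfl

lemma toLPAHom_surjective : Function.Surjective (toLPAHom E R) :=
  Quotient.exists_rep

instance : SMul R (E.LPA R) where
  smul r := Quotient.map (r • ·) fun a b h =>
    Quotient.exact (toLPA_eq_iff.2 (by
      rw [← smul_sub]
      exact smul_mem_relIdeal r (toLPA_eq_iff.1 (Quotient.sound h))))

lemma toLPAHom_smul (r : R) (a : E.FreeRing R) : toLPAHom E R (r • a) = r • toLPAHom E R a :=
  rfl

instance : Module R (E.LPA R) :=
  toLPAHom_surjective.module R (toLPAHom E R).toAddMonoidHom toLPAHom_smul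

lemma toLPAHom_eq_of_rel {a b : E.FreeRing R} (h : E.Rel R a b) :
    toLPAHom E R a = toLPAHom E R b :=
  toLPA_eq_iff.2 (sub_mem_relIdeal h)

variable (R) in
/-- A letter as an element of the weighted Leavitt path algebra. -/
def letterLPA (y : E.Letter) : E.LPA R := toLPAHom E R (letterElt R y)

lemma letterLPA_vertex_mul_vertex (x y : V) :
    letterLPA (E := E) R (.vertex x) * letterLPA R (.vertex y) =
      if x = y then letterLPA R (.vertex x) else 0 := by
  have h := toLPAHom_eq_of_rel (Rel.vertex_mul (R := R) (E := E) x y)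
  rw [map_mul, apply_ite (toLPAHom E R), map_zero] at h
  exact h

lemma letterLPA_vertex_src_mul (y : E.Letter) :
    letterLPA R (.vertex y.src) * letterLPA R y = letterLPA R y := by
  cases y with
  | vertex x => exact (letterLPA_vertex_mul_vertex x x).trans (if_pos rfl)
  | edge α i =>
    have h := toLPAHom_eq_of_rel (Rel.src_mul_edge (R := R) α i.1 i.2)
    rwa [map_mul, edgeElt, dif_pos i.2] at h
  | ghost α i =>
    have h := toLPAHom_eq_of_rel (Rel.tgt_mul_ghost (R := R) α i.1 i.2)
    rwa [map_mul, ghostElt, dif_pos i.2] at h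

lemma letterLPA_mul_vertex_tgt (y : E.Letter) :
    letterLPA R y * letterLPA R (.vertex y.tgt) = letterLPA R y := by
  cases y with
  | vertex x => exact (letterLPA_vertex_mul_vertex x x).trans (if_pos rfl)
  | edge α i =>
    have h := toLPAHom_eq_of_rel (Rel.edge_mul_tgt (R := R) α i.1 i.2)
    rwa [map_mul, edgeElt, dif_pos i.2] at h
  | ghost α i =>
    have h := toLPAHom_eq_of_rel (Rel.ghost_mul_src (R := R) α i.1 i.2)
    rwa [map_mul, ghostElt, dif_pos i.2] at h

lemma Letter.IsRedex.letterLPA_mul {y z : E.Letter} (h : IsRedex c y z) :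
    letterLPA R y * letterLPA R z = (if z = y.star then letterLPA R (.vertex y.src) else 0) -
      ∑ w ∈ reducts y z, letterLPA R w.1 * letterLPA R w.2 := by
  have hsum := toLPAHom_eq_of_rel (R := R) h.rel_sum_block
  simp only [map_sum, map_mul, apply_ite (toLPAHom E R), map_zero] at hsum
  rw [h.sum_block] at hsum
  exact eq_sub_of_add_eq hsum

lemma single_eq_smul_word (p : E.Word) (r : R) : MonoidAlgebra.single p r = r • E.word R p := by
  simp [word]

lemma word_of_mul (y : E.Letter) (p : E.Word) :
    E.word R (FreeSemigroup.of y * p) = letterElt R y * E.word R p := by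
  simp [letterElt, word]

/-- The word given by a path. -/
def pathWord : List E.Letter → V → E.Word
  | [], x => FreeSemigroup.of (.vertex x)
  | y :: l, _ => ⟨y, l⟩

variable (R) in
/-- A linear combination of paths as an element of the free `R`-ring. -/
def toFree : E.PathModule R →ₗ[R] E.FreeRing R :=
  (MonoidAlgebra.coeffLinearEquiv R).symm.toLinearMap ∘ₗ
    Finsupp.lmapDomain R R fun p => pathWord p.1 p.2

lemma toFree_pathElt (l : List E.Letter) (x : V) :
    toFree R (pathElt R l x) = E.word R (pathWord l x) := by
  simp [toFree, pathElt, word, Finsupp.mapDomain_single]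

variable (R) in
/-- A linear combination of paths as an element of the weighted Leavitt path algebra. -/
def pathLPA : E.PathModule R →ₗ[R] E.LPA R where
  toFun n := toLPAHom E R (toFree R n)
  map_add' m n := by rw [map_add, map_add]
  map_smul' r n := by rw [map_smul, toLPAHom_smul, RingHom.id_apply]

lemma pathLPA_nil (x : V) : pathLPA R (pathElt R [] x) = letterLPA (E := E) R (.vertex x) :=
  congrArg (toLPAHom E R) (toFree_pathElt [] x)

lemma pathLPA_cons {y : E.Letter} {l : List E.Letter} {x : V} (h : y.tgt = pathSrc l x) :
    pathLPA R (pathElt R (y :: l) x) = letterLPA R y * pathLPA R (pathElt R l x) := by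
  cases l with
  | nil =>
    rw [pathLPA_nil, ← show y.tgt = x from h, letterLPA_mul_vertex_tgt]
    exact congrArg (toLPAHom E R) (toFree_pathElt [y] _)
  | cons z l =>
    have hword : E.word R (pathWord (y :: z :: l) x) =
        letterElt R y * E.word R (pathWord (z :: l) x) :=
      word_of_mul y (pathWord (z :: l) x)
    simp only [pathLPA, LinearMap.coe_mk, AddHom.coe_mk, toFree_pathElt, hword, map_mul, letterLPA]

instance : IsScalarTower R (E.LPA R) (E.LPA R) where
  smul_assoc r a b := by
    obtain ⟨a, rfl⟩ := toLPAHom_surjective a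
    obtain ⟨b, rfl⟩ := toLPAHom_surjective b
    change toLPAHom E R (r • a) * _ = r • (toLPAHom E R a * _)
    rw [← map_mul, ← map_mul, ← toLPAHom_smul, smul_mul_assoc]

lemma letterElt_mul_smul (y : E.Letter) (r : R) (a : E.FreeRing R) :
    letterElt R y * r • a = r • (letterElt R y * a) := by
  induction a using MonoidAlgebra.induction_linear with
  | zero => simp
  | add a b ha hb => rw [smul_add, mul_add, mul_add, smul_add, ha, hb]
  | single q s => simp [letterElt, word]

variable (R) in
/-- Left multiplication by a letter on the weighted Leavitt path algebra; it is `R`-linear because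
the letters commute with the scalars. -/
def letterMulLeft (y : E.Letter) : E.LPA R →ₗ[R] E.LPA R where
  toFun a := letterLPA R y * a
  map_add' := mul_add _
  map_smul' r a := by
    obtain ⟨a, rfl⟩ := toLPAHom_surjective a
    rw [letterLPA, ← toLPAHom_smul, ← map_mul, letterElt_mul_smul, toLPAHom_smul, map_mul]
    rfl

lemma letterLPA_vertex_pathSrc_mul {l : List E.Letter} {x : V} (h : IsNormalPath c l x) :
    letterLPA R (.vertex (pathSrc l x)) * pathLPA R (pathElt R l x) =
      pathLPA R (pathElt R l x) := by
  cases l with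
  | nil =>
    rw [pathLPA_nil]
    exact letterLPA_vertex_src_mul (.vertex x)
  | cons y l =>
    rw [pathLPA_cons h.2.1, ← mul_assoc]
    exact congrArg (· * _) (letterLPA_vertex_src_mul y)

lemma letterLPA_mul_pathLPA_pathElt (c : E.SpecialEdges) (y : E.Letter) {l : List E.Letter} {x : V}
    (h : IsNormalPath c l x) :
    letterLPA R y * pathLPA R (pathElt R l x) = pathLPA R (letterEnd R c y (pathElt R l x)) := by
  by_cases htgt : y.tgt = pathSrc l x
  swap
  · rw [letterEnd_pathElt_of_tgt_ne htgt, map_zero, ← letterLPA_mul_vertex_tgt,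
      ← letterLPA_vertex_pathSrc_mul h, ← mul_assoc, mul_assoc (letterLPA R y),
      letterLPA_vertex_mul_vertex, if_neg htgt, mul_zero, zero_mul]
  by_cases hy : y.IsVertex
  · obtain ⟨v, rfl⟩ := hy
    obtain rfl : v = pathSrc l x := htgt
    rw [letterEnd_vertex_pathElt, if_pos rfl, letterLPA_vertex_pathSrc_mul h]
  obtain hyl | ⟨z, l, rfl, hyz⟩ := h.cons_or_exists_isRedex hy htgt
  · rw [letterEnd_pathElt_of_isNormalPath hyl, pathLPA_cons htgt]
  have hz : z.tgt = pathSrc l x := h.2.1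
  have hreducts : ∀ w ∈ reducts y z, letterLPA R w.1 * letterLPA R w.2 * pathLPA R (pathElt R l x) =
      pathLPA R (pathElt R (w.1 :: w.2 :: l) x) := fun w hw => by
    obtain ⟨-, hw₁, -, -, hw₂, -⟩ := h.reduct hyz htgt hw
    rw [pathLPA_cons hw₁, pathLPA_cons hw₂, mul_assoc]
  have hvertex : z = y.star → letterLPA R (.vertex y.src) * pathLPA R (pathElt R l x) =
      pathLPA R (pathElt R l x) := fun hstar => by
    rw [show y.src = pathSrc l x by rw [← hz, hstar, tgt_star], letterLPA_vertex_pathSrc_mul h.tail]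
  rw [pathLPA_cons hz, ← mul_assoc, hyz.letterLPA_mul, letterEnd_pathElt_of_isRedex hyz htgt,
    map_sub, map_sum, sub_mul, Finset.sum_mul, Finset.sum_congr rfl hreducts]
  congr 1
  split_ifs with hstar
  · exact hvertex hstar
  · rw [zero_mul, map_zero]

lemma letterLPA_mul_pathLPA (y : E.Letter) {n : E.PathModule R} (hn : n ∈ normalPaths R c ⊤) :
    letterLPA R y * pathLPA R n = pathLPA R (letterEnd R c y n) := by
  have hle : normalPaths R c ⊤ ≤
      LinearMap.eqLocus (letterMulLeft R y ∘ₗ pathLPA R) (pathLPA R ∘ₗ letterEnd R c y) :=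
    supported_le_of_pathElt_mem fun p hp => letterLPA_mul_pathLPA_pathElt c y hp.1
  exact hle hn

lemma toLPAHom_mul_pathLPA (a : E.FreeRing R) {n : E.PathModule R} (hn : n ∈ normalPaths R c ⊤) :
    toLPAHom E R a * pathLPA R n = pathLPA R (act R c n a) := by
  induction a using MonoidAlgebra.induction_linear with
  | zero => rw [map_zero, map_zero, map_zero, zero_mul]
  | add a b ha hb => rw [map_add, map_add, map_add, add_mul, ha, hb]
  | single p r =>
    rw [single_eq_smul_word, toLPAHom_smul, smul_mul_assoc, map_smul, map_smul]
    congr 1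
    induction p using FreeSemigroup.recOnMul with
    | ih1 y => exact (letterLPA_mul_pathLPA y hn).trans (by rw [← letterElt, act_letterElt])
    | ih2 y p _ hp =>
      rw [word_of_mul, map_mul, mul_assoc, hp, act_mul, act_letterElt,
        ← letterLPA_mul_pathLPA y (act_mem_normalPaths _ hn)]
      rfl

lemma map_pathLPA_normalPaths (c : E.SpecialEdges) :
    (normalPaths R c ⊤).map (pathLPA R) = ⊤ := by
  refine (Submodule.eq_top_iff').2 fun a => ?_
  obtain ⟨a, rfl⟩ := toLPAHom_surjective a
  induction a using MonoidAlgebra.induction_linear with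
  | zero => exact zero_mem _
  | add a b ha hb => exact add_mem ha hb
  | single p r =>
    rw [single_eq_smul_word, toLPAHom_smul]
    refine Submodule.smul_mem _ _ ?_
    induction p using FreeSemigroup.recOnMul with
    | ih1 y =>
      have hv : pathElt R [] y.tgt ∈ normalPaths R c ⊤ := pathElt_mem_normalPaths trivial le_top
      refine ⟨letterEnd R c y (pathElt R [] y.tgt), letterEnd_mem_normalPaths hv, ?_⟩
      rw [← letterLPA_mul_pathLPA y hv, pathLPA_nil, letterLPA_mul_vertex_tgt]
      rfl
    | ih2 y p _ hp =>
      obtain ⟨n, hn, hnp⟩ := hp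
      refine ⟨letterEnd R c y n, letterEnd_mem_normalPaths hn, ?_⟩
      rw [← letterLPA_mul_pathLPA y hn, hnp, word_of_mul, map_mul]
      rfl

lemma exists_pathLPA_eq (c : E.SpecialEdges) (a : E.LPA R) :
    ∃ n ∈ normalPaths R c ⊤, pathLPA R n = a :=
  (Submodule.eq_top_iff').1 (map_pathLPA_normalPaths c) a

lemma wordEnd_pathWord_cons {y : E.Letter} {l : List E.Letter} {x : V} (h : y.tgt = pathSrc l x)
    (n : E.PathModule R) :
    wordEnd R c (pathWord (y :: l) x) n = letterEnd R c y (wordEnd R c (pathWord l x) n) := by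
  cases l with
  | nil =>
    obtain rfl : y.tgt = x := h
    exact (letterEnd_letterEnd_vertex_tgt y n).symm
  | cons z l =>
    rw [show pathWord (y :: z :: l) x = FreeSemigroup.of y * pathWord (z :: l) x from rfl, map_mul]
    rfl

lemma wordEnd_pathWord_pathElt {l l' : List E.Letter} {x : V} (h : IsNormalPath c (l ++ l') x) :
    wordEnd R c (pathWord l (pathSrc l' x)) (pathElt R l' x) = pathElt R (l ++ l') x := by
  induction l with
  | nil => exact letterEnd_vertex_of_mem_pathsFrom (pathElt_mem_pathsFrom rfl)
  | cons y l ih =>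
    rw [wordEnd_pathWord_cons, ih h.tail]
    · exact letterEnd_pathElt_of_isNormalPath h
    · cases l <;> exact h.2.1

lemma wordEnd_pathWord_mem_normalPaths {l : List E.Letter} {x : V} (h : IsNormalPath c l x)
    {k : ℕ∞} {n : E.PathModule R} (hn : n ∈ normalPaths R c k ⊓ pathsFrom R x) :
    wordEnd R c (pathWord l x) n ∈ normalPaths R c (l.length + k) := by
  induction l with
  | nil =>
    rw [show wordEnd R c (pathWord [] x) n = n from letterEnd_vertex_of_mem_pathsFrom hn.2]
    simpa using hn.1
  | cons y l ih =>
    rw [wordEnd_pathWord_cons h.2.1, List.length_cons, Nat.cast_add, add_right_comm]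
    exact letterEnd_mem_normalPaths (ih h.tail)

lemma pathLPA_mul_vertex {l : List E.Letter} {x v : V} (h : IsNormalPath c l x) :
    pathLPA R (pathElt R l x) * letterLPA R (.vertex v) =
      if x = v then pathLPA R (pathElt R l x) else 0 := by
  induction l with
  | nil => rw [pathLPA_nil, letterLPA_vertex_mul_vertex]
  | cons y l ih => rw [pathLPA_cons h.2.1, mul_assoc, ih h.tail, mul_ite, mul_zero]

variable (R) in
/-- The span of the paths with range `v`. -/
def pathsTo (v : V) : Submodule R (E.PathModule R) :=
  Finsupp.supported R R {p | p.2 = v}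

lemma exists_pathLPA_eq_mul_vertex (c : E.SpecialEdges) (a : E.LPA R) (v : V) :
    ∃ m ∈ normalPaths R c ⊤ ⊓ pathsTo R v, pathLPA R m = a * letterLPA R (.vertex v) := by
  obtain ⟨n, hn, rfl⟩ := exists_pathLPA_eq c a
  have hle : normalPaths R c ⊤ ≤ ((normalPaths R c ⊤ ⊓ pathsTo R v).map (pathLPA R)).comap
      (LinearMap.mulRight R (letterLPA R (.vertex v)) ∘ₗ pathLPA R) :=
    supported_le_of_pathElt_mem fun ⟨l, x⟩ hp => by
      change pathLPA R (pathElt R l x) * letterLPA R (.vertex v) ∈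
        (normalPaths R c ⊤ ⊓ pathsTo R v).map (pathLPA R)
      rw [pathLPA_mul_vertex hp.1]
      split_ifs with hx
      · exact ⟨_, ⟨pathElt_mem_normalPaths hp.1 hp.2, Finsupp.single_mem_supported R 1 hx⟩, rfl⟩
      · exact zero_mem _
  exact hle hn

lemma exists_pathLPA_eq_vertex_mul (c : E.SpecialEdges) (b : E.LPA R) (v : V) :
    ∃ n ∈ normalPaths R c ⊤ ⊓ pathsFrom R v, pathLPA R n = letterLPA R (.vertex v) * b := by
  obtain ⟨n, hn, rfl⟩ := exists_pathLPA_eq c b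
  exact ⟨letterEnd R c (.vertex v) n, ⟨letterEnd_mem_normalPaths hn, letterEnd_mem_pathsFrom hn⟩,
    (letterLPA_mul_pathLPA _ hn).symm⟩

lemma wordEnd_pathWord_pathElt_nil {l : List E.Letter} {x : V} (h : IsNormalPath c l x) (v : V) :
    wordEnd R c (pathWord l x) (pathElt R [] v) = if x = v then pathElt R l x else 0 := by
  induction l with
  | nil =>
    refine (letterEnd_vertex_pathElt x).trans ?_
    change (if x = v then pathElt R [] v else 0) = _
    split_ifs with hx
    · rw [hx]
    · rfl
  | cons y l ih =>
    rw [wordEnd_pathWord_cons h.2.1, ih h.tail, apply_ite (letterEnd R c y),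
      letterEnd_pathElt_of_isNormalPath h, map_zero]

lemma act_pathElt_nil_toFree_apply {m : E.PathModule R} (hm : m ∈ normalPaths R c ⊤)
    (l : List E.Letter) (x : V) : act R c (pathElt R [] x) (toFree R m) (l, x) = m (l, x) := by
  have hle : normalPaths R c ⊤ ≤ LinearMap.eqLocus
      (Finsupp.lapply (l, x) ∘ₗ act R c (pathElt R [] x) ∘ₗ toFree R) (Finsupp.lapply (l, x)) :=
    supported_le_of_pathElt_mem fun ⟨l', y⟩ hp => by
      change act R c (pathElt R [] x) (toFree R (pathElt R l' y)) (l, x) = pathElt R l' y (l, x)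
      rw [toFree_pathElt, word, act_single, one_smul, wordEnd_pathWord_pathElt_nil hp.1]
      split_ifs with hy
      · rfl
      · simp [pathElt, hy]
  exact hle hm

lemma pathLPA_injOn (c : E.SpecialEdges) :
    Set.InjOn (pathLPA R) (normalPaths R c ⊤ : Set (E.PathModule R)) := by
  intro m hm n hn h
  have hsub : toFree R (m - n) ∈ E.relIdeal R := by
    rw [map_sub]
    exact toLPA_eq_iff.1 h
  refine sub_eq_zero.1 (Finsupp.ext fun p => ?_)
  have hp : pathElt R [] p.2 ∈ normalPaths R c ⊤ := pathElt_mem_normalPaths trivial le_top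
  rw [← Prod.mk.eta (p := p), ← act_pathElt_nil_toFree_apply (sub_mem hm hn),
    mem_annihilator.1 (relIdeal_le_annihilator c hsub) _ hp]

/-! ### Normal forms -/

lemma Letter.isRedex_iff_exists_word {y z : E.Letter} :
    IsRedex c y z ↔ ∃ q : E.Word, (q.IsTypeI c ∨ q.IsTypeII) ∧ q.letters = [y, z] := by
  constructor
  · intro h
    match y, z, h with
    | .edge α i, .ghost β j, h =>
      obtain ⟨rfl, x, rfl⟩ := h
      exact ⟨_, .inl ⟨x, i, j, rfl⟩, rfl⟩
    | .ghost α i, .edge β j, h =>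
      obtain rfl : i = ⟨0, E.weight_pos α⟩ := Fin.ext h.1
      obtain rfl : j = ⟨0, E.weight_pos β⟩ := Fin.ext h.2
      exact ⟨_, .inr ⟨α, β, rfl⟩, rfl⟩
  · rintro ⟨q, ⟨x, i, j, rfl⟩ | ⟨α, β, rfl⟩, h⟩
    · obtain ⟨rfl, rfl⟩ : .edge _ i = y ∧ .ghost _ j = z := by
        simpa [Word.letters, FreeSemigroup.of] using h
      exact ⟨rfl, x, rfl⟩
    · obtain ⟨rfl, rfl⟩ :
          .ghost α ⟨0, E.weight_pos α⟩ = y ∧ .edge β ⟨0, E.weight_pos β⟩ = z := by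
        simpa [Word.letters, FreeSemigroup.of] using h
      exact ⟨rfl, rfl⟩

section

variable {l : List E.Letter} {x : V}

lemma IsNormalPath.not_isVertex (h : IsNormalPath c l x) : ∀ y ∈ l, ¬ y.IsVertex := by
  induction l with
  | nil => simp
  | cons y l ih => exact List.forall_mem_cons.2 ⟨h.1, ih h.tail⟩

lemma IsNormalPath.isChain (h : IsNormalPath c l x) :
    l.IsChain (fun y z => y.tgt = z.src ∧ ¬ IsRedex c y z) := by
  induction l with
  | nil => exact List.isChain_nil
  | cons y l ih =>
    cases l with
    | nil => exact List.isChain_singleton _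
    | cons z l => exact List.isChain_cons_cons.2 ⟨⟨h.2.1, h.2.2.1 z rfl⟩, ih h.tail⟩

lemma IsNormalPath.not_isRedex_of_infix {y z : E.Letter} (h : IsNormalPath c l x)
    (hyz : [y, z] <:+: l) : ¬ IsRedex c y z :=
  (List.isChain_cons_cons.1 (h.isChain.infix hyz)).1.2

lemma exists_isNormalPath_of_isChain {y : E.Letter} (hvertex : ∀ z ∈ y :: l, ¬ z.IsVertex)
    (hchain : (y :: l).IsChain (fun y z => y.tgt = z.src ∧ ¬ IsRedex c y z)) :
    ∃ x, IsNormalPath c (y :: l) x := by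
  induction l generalizing y with
  | nil => exact ⟨y.tgt, hvertex y List.mem_cons_self, rfl, by simp, trivial⟩
  | cons z l ih =>
    rw [List.isChain_cons_cons] at hchain
    obtain ⟨x, hx⟩ := ih (List.forall_mem_cons.1 hvertex).2 hchain.2
    exact ⟨x, hvertex y List.mem_cons_self, hchain.1.1, by simpa using hchain.1.2, hx⟩

lemma IsNormalPath.isTrivial_pathWord_iff (h : IsNormalPath c l x) :
    (pathWord l x).IsTrivial ↔ l = [] := by
  constructor
  · rintro ⟨y, hy⟩
    cases l with
    | nil => rfl
    | cons z l => exact (h.1 ⟨y, congrArg FreeSemigroup.head hy⟩).elim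
  · rintro rfl
    exact ⟨x, rfl⟩

lemma IsNormalPath.pathLength_pathWord (h : IsNormalPath c l x) :
    (pathWord l x).pathLength = l.length := by
  rw [Word.pathLength, h.isTrivial_pathWord_iff]
  cases l with
  | nil => exact if_pos rfl
  | cons y l => exact if_neg (List.cons_ne_nil y l)

lemma IsNormalPath.isNormal_pathWord (h : IsNormalPath c l x) : (pathWord l x).IsNormal c := by
  cases l with
  | nil =>
    refine ⟨.inl ⟨x, rfl⟩, ?_⟩
    rintro _ (⟨x, i, j, rfl⟩ | ⟨α, β, rfl⟩) hinfix <;>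
      simpa [Word.letters, pathWord, FreeSemigroup.of] using hinfix.length_le
  | cons y l =>
    refine ⟨.inr ⟨h.not_isVertex, h.isChain.imp fun _ _ h => h.1⟩, fun q hq hinfix => ?_⟩
    obtain ⟨z, t, hzt⟩ : ∃ z t : E.Letter, q.letters = [z, t] := by
      obtain ⟨x, i, j, rfl⟩ | ⟨α, β, rfl⟩ := hq <;> exact ⟨_, _, rfl⟩
    exact h.not_isRedex_of_infix (hzt ▸ hinfix) (isRedex_iff_exists_word.2 ⟨q, hq, hzt⟩)

lemma IsNormalPath.range_unique {y : E.Letter} {x' : V} (h : IsNormalPath c (y :: l) x)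
    (h' : IsNormalPath c (y :: l) x') : x = x' := by
  induction l generalizing y with
  | nil => exact h.2.1.symm.trans h'.2.1
  | cons z l ih => exact ih h.tail h'.tail

end

lemma pathWord_image_isNormalPath (c : E.SpecialEdges) :
    (fun p : List E.Letter × V => pathWord p.1 p.2) '' {p | IsNormalPath c p.1 p.2} =
      {p | p.IsNormal c} := by
  refine Set.Subset.antisymm ?_ fun p hp => ?_
  · rintro _ ⟨p, hp, rfl⟩
    exact hp.isNormal_pathWord
  obtain ⟨⟨x, rfl⟩ | ⟨hvertex, hcomp⟩, hred⟩ := hp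
  · exact ⟨([], x), trivial, rfl⟩
  have hchain : p.letters.IsChain fun y z => y.tgt = z.src ∧ ¬ IsRedex c y z := by
    rw [List.isChain_iff_forall_rel_of_append_cons_cons] at hcomp ⊢
    refine fun y z l l' hp => ⟨hcomp hp, fun hyz => ?_⟩
    obtain ⟨q, hq, hqyz⟩ := isRedex_iff_exists_word.1 hyz
    exact hred q hq ⟨l, l', by rw [hqyz, hp]; simp⟩
  obtain ⟨x, hx⟩ := exists_isNormalPath_of_isChain hvertex hchain
  exact ⟨(p.letters, x), hx, rfl⟩

lemma pathWord_injOn (c : E.SpecialEdges) :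
    Set.InjOn (fun p : List E.Letter × V => pathWord p.1 p.2) {p | IsNormalPath c p.1 p.2} := by
  rintro ⟨l, x⟩ h ⟨l', x'⟩ h' heq
  cases l with
  | nil =>
    obtain rfl : l' = [] := h'.isTrivial_pathWord_iff.1 ⟨x, heq.symm⟩
    obtain rfl : x = x' := by simpa [pathWord, FreeSemigroup.of] using heq
    rfl
  | cons y l =>
    cases l' with
    | nil => cases h.isTrivial_pathWord_iff.1 ⟨x', heq⟩
    | cons y' l' =>
      obtain ⟨rfl, rfl⟩ : y = y' ∧ l = l' := by simpa [pathWord] using heq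
      obtain rfl := h.range_unique h'
      rfl

lemma normalPaths_top (c : E.SpecialEdges) :
    normalPaths R c ⊤ = Finsupp.supported R R {p | IsNormalPath c p.1 p.2} := by
  simp only [normalPaths, le_top, and_true]

lemma isNormalElt_iff_exists_toFree_eq {f : E.FreeRing R} :
    IsNormalElt c f ↔ ∃ m ∈ normalPaths R c ⊤, toFree R m = f := by
  have hmap := Finsupp.lmapDomain_supported (M := R) R
    (fun p : List E.Letter × V => pathWord p.1 p.2) {p | IsNormalPath c p.1 p.2}
  rw [pathWord_image_isNormalPath, ← normalPaths_top] at hmap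
  change f.coeff ∈ Finsupp.supported R R {p : E.Word | p.IsNormal c} ↔ _
  rw [← hmap]
  refine exists_congr fun m => and_congr_right fun _ => ?_
  exact ((MonoidAlgebra.coeffLinearEquiv R).symm_apply_eq).symm

lemma existsUnique_isNormalRep (c : E.SpecialEdges) (a : E.LPA R) :
    ∃! f : E.FreeRing R, IsNormalRep c a f := by
  obtain ⟨m, hm, rfl⟩ := exists_pathLPA_eq c a
  refine ⟨toFree R m, ⟨isNormalElt_iff_exists_toFree_eq.2 ⟨m, hm, rfl⟩, rfl⟩, ?_⟩
  rintro f ⟨hf, hfm⟩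
  obtain ⟨n, hn, rfl⟩ := isNormalElt_iff_exists_toFree_eq.1 hf
  rw [pathLPA_injOn c hn hm hfm]

section

variable {m : E.PathModule R} (hm : m ∈ normalPaths R c ⊤)
include hm

lemma NF_pathLPA : NF c (pathLPA R m) = toFree R m := by
  have h := existsUnique_isNormalRep c (pathLPA R m)
  rw [NF, dif_pos h.exists]
  exact h.unique h.exists.choose_spec ⟨isNormalElt_iff_exists_toFree_eq.2 ⟨m, hm, rfl⟩, rfl⟩

lemma supp_pathLPA : supp c (pathLPA R m) = m.support.image fun p => pathWord p.1 p.2 := by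
  rw [supp, NF_pathLPA hm]
  exact Finsupp.mapDomain_support_of_injOn _ ((pathWord_injOn c).mono fun p hp => (hm hp).1)

end

/-- The maximal length of a path in the support. -/
def pathDegree (m : E.PathModule R) : WithBot ℕ := m.support.sup fun p => (p.1.length : WithBot ℕ)

lemma maxLength_pathLPA {m : E.PathModule R} (hm : m ∈ normalPaths R c ⊤) :
    maxLength c (pathLPA R m) = pathDegree m := by
  rw [maxLength, supp_pathLPA hm, Finset.sup_image]
  refine Finset.sup_congr rfl fun p hp => ?_
  rw [Function.comp_apply, (hm hp).1.pathLength_pathWord]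

lemma pathDegree_le_iff {m : E.PathModule R} {k : ℕ} (hm : m ∈ normalPaths R c ⊤) :
    pathDegree m ≤ k ↔ m ∈ normalPaths R c k := by
  simp only [pathDegree, Finset.sup_le_iff, Nat.cast_le]
  exact forall₂_congr fun p hp =>
    ⟨fun hk => ⟨(hm hp).1, Nat.cast_le.2 hk⟩, fun hpk => Nat.cast_le.1 hpk.2⟩

lemma length_le_pathDegree {m : E.PathModule R} {p : List E.Letter × V} (hp : m p ≠ 0) :
    (p.1.length : WithBot ℕ) ≤ pathDegree m :=
  Finset.le_sup (f := fun p : List E.Letter × V => (p.1.length : WithBot ℕ))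
    (Finsupp.mem_support_iff.2 hp)

lemma exists_pathDegree_eq {m : E.PathModule R} (hm : m ≠ 0) :
    ∃ p, m p ≠ 0 ∧ pathDegree m = (p.1.length : WithBot ℕ) := by
  obtain ⟨p, hp, h⟩ := m.support.exists_mem_eq_sup (Finsupp.support_nonempty_iff.2 hm)
    fun p => (p.1.length : WithBot ℕ)
  exact ⟨p, Finsupp.mem_support_iff.1 hp, h⟩

lemma pathDegree_zero : pathDegree (0 : E.PathModule R) = ⊥ :=
  Finset.sup_empty

lemma pathDegree_eq_bot_iff {m : E.PathModule R} : pathDegree m = ⊥ ↔ m = 0 := by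
  refine ⟨fun h => ?_, fun h => h ▸ pathDegree_zero⟩
  by_contra hm
  obtain ⟨p, -, hp⟩ := exists_pathDegree_eq hm
  exact WithBot.bot_ne_coe (h.symm.trans hp)

lemma pathDegree_eq_zero_iff {m : E.PathModule R} :
    pathDegree m = 0 ↔ m ≠ 0 ∧ ∀ p ∈ m.support, p.1 = [] := by
  constructor
  · intro h
    refine ⟨fun hm => WithBot.bot_ne_zero ((pathDegree_eq_bot_iff.2 hm).symm.trans h),
      fun p hp => ?_⟩
    have hle := length_le_pathDegree (Finsupp.mem_support_iff.1 hp)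
    rw [h] at hle
    exact List.length_eq_zero_iff.1 (Nat.le_zero.1 (by exact_mod_cast hle))
  · rintro ⟨hm, h⟩
    obtain ⟨p, hp, hdeg⟩ := exists_pathDegree_eq hm
    rw [hdeg, h p (Finsupp.mem_support_iff.2 hp)]
    rfl

lemma pathDegree_add_le (m n : E.PathModule R) :
    pathDegree (m + n) ≤ max (pathDegree m) (pathDegree n) := by
  rw [pathDegree, pathDegree, pathDegree, ← Finset.sup_union]
  exact Finset.sup_mono Finsupp.support_add

/-! ### Degrees of products -/

section

variable {l l' P Q T : List E.Letter} {x x₀ : V} {y z : E.Letter}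

lemma pathSrc_append (l l' : List E.Letter) (x : V) :
    pathSrc (l ++ l') x = pathSrc l (pathSrc l' x) := by
  cases l <;> rfl

lemma IsNormalPath.append_or_exists_isRedex (h : IsNormalPath c l (pathSrc l' x))
    (h' : IsNormalPath c l' x) : IsNormalPath c (l ++ l') x ∨
      ∃ P y z Q, l = P ++ [y] ∧ l' = z :: Q ∧ IsRedex c y z := by
  induction l with
  | nil => exact .inl h'
  | cons y l ih =>
    obtain hl | ⟨P, t, z, Q, rfl, hz, htz⟩ := ih h.tail
    · obtain hyl | ⟨z, Q, hz, hyz⟩ :=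
        hl.cons_or_exists_isRedex h.1 (h.2.1.trans (pathSrc_append l l' x).symm)
      · exact .inl hyl
      · cases l with
        | nil => exact .inr ⟨[], y, z, Q, rfl, hz, hyz⟩
        | cons t l =>
          obtain ⟨rfl, -⟩ := List.cons.inj hz
          exact absurd hyz (h.2.2.1 t rfl)
    · exact .inr ⟨y :: P, t, z, Q, rfl, hz, htz⟩

lemma IsNormalPath.tgt_of_concat (h : IsNormalPath c (P ++ [y]) x) : y.tgt = x := by
  induction P with
  | nil => exact h.2.1
  | cons t P ih => exact ih h.tail

lemma IsNormalPath.append_reduct (h : IsNormalPath c (P ++ [y]) z.src)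
    (h' : IsNormalPath c (z :: Q) x) (hyz : IsRedex c y z) {w : E.Letter × E.Letter}
    (hw : w ∈ reducts y z) : IsNormalPath c (P ++ w.1 :: w.2 :: Q) x := by
  induction P with
  | nil => exact h'.reduct hyz h.tgt_of_concat hw
  | cons t P ih =>
    rw [List.cons_append] at h ⊢
    obtain ⟨ht, hcomp, hred, hP⟩ := isNormalPath_cons.1 h
    have hwb := Finset.mem_of_mem_erase hw
    refine ⟨ht, ?_, ?_, ih hP⟩
    · rw [hcomp, pathSrc_append, pathSrc_append]
      exact congrArg (pathSrc P) (src_eq_of_mem_block hwb).symm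
    · cases P with
      | nil => simpa [isRedex_left_iff_of_mem_block hwb] using hred
      | cons s P => exact hred

lemma IsNormalPath.of_concat (h : IsNormalPath c (P ++ [y]) x) : IsNormalPath c P y.src := by
  induction P with
  | nil => trivial
  | cons t P ih =>
    rw [List.cons_append] at h
    obtain ⟨ht, hcomp, hred, hP⟩ := isNormalPath_cons.1 h
    refine ⟨ht, hcomp.trans (pathSrc_append P [y] x), fun s hs => hred s ?_, ih hP⟩
    rw [List.head?_append, hs]
    rfl

lemma wordEnd_pathWord_concat (h : IsNormalPath c (P ++ [y]) x) {n : E.PathModule R}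
    (hn : n ∈ normalPaths R c ⊤) :
    wordEnd R c (pathWord (P ++ [y]) x) n = wordEnd R c (pathWord P y.src) (letterEnd R c y n) := by
  induction P with
  | nil => exact (letterEnd_vertex_of_mem_pathsFrom (letterEnd_mem_pathsFrom hn)).symm
  | cons t P ih =>
    have hcomp : t.tgt = pathSrc P y.src := (IsNormalPath.of_concat (P := t :: P) h).2.1
    rw [List.cons_append] at h ⊢
    rw [wordEnd_pathWord_cons h.2.1, ih h.tail, wordEnd_pathWord_cons hcomp]

lemma wordEnd_pathWord_pathElt_add_mem (h : IsNormalPath c (P ++ [y]) z.src)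
    (h' : IsNormalPath c (z :: Q) x) (hyz : IsRedex c y z) :
    wordEnd R c (pathWord (P ++ [y]) z.src) (pathElt R (z :: Q) x) +
        ∑ w ∈ reducts y z, pathElt R (P ++ w.1 :: w.2 :: Q) x ∈
      normalPaths R c (P.length + Q.length) := by
  have hsum : ∑ w ∈ reducts y z, pathElt R (P ++ w.1 :: w.2 :: Q) x =
      ∑ w ∈ reducts y z, wordEnd R c (pathWord P y.src) (pathElt R (w.1 :: w.2 :: Q) x) :=
    Finset.sum_congr rfl fun w hw => by
      rw [← wordEnd_pathWord_pathElt (h.append_reduct h' hyz hw), pathSrc,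
        src_eq_of_mem_block (Finset.mem_of_mem_erase hw)]
  rw [wordEnd_pathWord_concat h (pathElt_mem_normalPaths h' le_top),
    letterEnd_pathElt_of_isRedex hyz h.tgt_of_concat, map_sub, map_sum, hsum, sub_add_cancel]
  refine wordEnd_pathWord_mem_normalPaths h.of_concat ?_
  split_ifs with hstar
  · refine ⟨pathElt_mem_normalPaths h'.tail le_rfl, pathElt_mem_pathsFrom ?_⟩
    rw [← h'.2.1, hstar, tgt_star]
  · exact zero_mem _

lemma pathElt_apply (l l₀ : List E.Letter) (x x₀ : V) :
    pathElt R l x (l₀, x₀) = if l = l₀ ∧ x = x₀ then 1 else 0 := by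
  simp only [pathElt, Finsupp.single_apply, Prod.mk.injEq]

lemma wordEnd_pathWord_pathElt_apply_of_isRedex (h : IsNormalPath c (P ++ [y]) z.src)
    (h' : IsNormalPath c (z :: Q) x) (hyz : IsRedex c y z) (hT : P.length + Q.length < T.length) :
    wordEnd R c (pathWord (P ++ [y]) z.src) (pathElt R (z :: Q) x) (T, x₀) =
      if (∃ w ∈ reducts y z, P ++ w.1 :: w.2 :: Q = T) ∧ x = x₀ then -1 else 0 := by
  have hlow := wordEnd_pathWord_pathElt_add_mem (R := R) h h' hyz
  have hzero : (wordEnd R c (pathWord (P ++ [y]) z.src) (pathElt R (z :: Q) x) +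
      ∑ w ∈ reducts y z, pathElt R (P ++ w.1 :: w.2 :: Q) x) (T, x₀) = 0 :=
    Finsupp.notMem_support_iff.1 fun hmem => hT.not_ge (by exact_mod_cast (hlow hmem).2)
  rw [Finsupp.add_apply, Finsupp.finsetSum_apply] at hzero
  rw [eq_neg_of_add_eq_zero_left hzero]
  simp only [pathElt_apply]
  split_ifs with hex
  · obtain ⟨⟨w, hw, rfl⟩, rfl⟩ := hex
    rw [Finset.sum_eq_single_of_mem w hw, if_pos ⟨rfl, rfl⟩]
    refine fun w' _ hne => if_neg fun heq => hne ?_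
    have := List.append_cancel_left heq.1
    simp only [List.cons.injEq] at this
    exact Prod.ext this.1 this.2.1
  · rw [Finset.sum_eq_zero fun w hw => if_neg fun heq => hex ⟨⟨w, hw, heq.1⟩, heq.2⟩, neg_zero]

lemma append_eq_append_iff_of_length_le {l₀ l₀' : List E.Letter} (h : l.length ≤ l₀.length)
    (h' : l'.length ≤ l₀'.length) : l ++ l' = l₀ ++ l₀' ↔ l = l₀ ∧ l' = l₀' := by
  refine ⟨fun heq => List.append_inj heq ?_, fun heq => by rw [heq.1, heq.2]⟩
  have := congrArg List.length heq
  simp only [List.length_append] at this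
  omega

lemma append_cons_cons_eq_iff_of_length_le {l₀ l₀' : List E.Letter}
    (h : (P ++ [y]).length ≤ l₀.length) (h' : (z :: Q).length ≤ l₀'.length) :
    P ++ y :: z :: Q = l₀ ++ l₀' ↔ P ++ [y] = l₀ ∧ z :: Q = l₀' := by
  rw [← append_eq_append_iff_of_length_le h h', List.append_cons]

lemma wordEnd_pathWord_pathElt_append_apply {l₀ l₀' : List E.Letter}
    (hfree : ∀ P y z Q, l₀ = P ++ [y] → l₀' = z :: Q → block y z = ∅)
    (h : IsNormalPath c l (pathSrc l' x)) (h' : IsNormalPath c l' x)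
    (hlen : l.length ≤ l₀.length) (hlen' : l'.length ≤ l₀'.length) :
    wordEnd R c (pathWord l (pathSrc l' x)) (pathElt R l' x) (l₀ ++ l₀', x₀) =
      if l = l₀ ∧ l' = l₀' ∧ x = x₀ then 1 else 0 := by
  obtain happ | ⟨P, y, z, Q, rfl, rfl, hyz⟩ := h.append_or_exists_isRedex h'
  · simp only [wordEnd_pathWord_pathElt happ, pathElt_apply,
      append_eq_append_iff_of_length_le hlen hlen', and_assoc]
  have hT : P.length + Q.length < (l₀ ++ l₀').length := by
    simp only [List.length_append, List.length_cons] at hlen hlen' ⊢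
    omega
  refine (wordEnd_pathWord_pathElt_apply_of_isRedex h h' hyz hT).trans ?_
  rw [if_neg, if_neg]
  · rintro ⟨hP, hQ, -⟩
    exact Finset.notMem_empty _ (hfree P y z Q hP.symm hQ.symm ▸ hyz.mem_block)
  · rintro ⟨⟨w, hw, heq⟩, -⟩
    have hwb := Finset.mem_of_mem_erase hw
    obtain ⟨hP, hQ⟩ := (append_cons_cons_eq_iff_of_length_le
      (by simpa using hlen) (by simpa using hlen')).1 heq
    rw [← block_eq_of_mem hwb, hfree P w.1 w.2 Q hP.symm hQ.symm] at hwb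
    exact Finset.notMem_empty _ hwb

lemma exists_mem_reducts_append_eq_iff {y₀ z₀ : E.Letter} {w : E.Letter × E.Letter}
    {P₀ Q₀ : List E.Letter} (hyz : IsRedex c y z) (hyz₀ : IsRedex c y₀ z₀) (hw : w ∈ reducts y₀ z₀)
    (hlen : P.length ≤ P₀.length) (hlen' : Q.length ≤ Q₀.length) :
    (∃ w' ∈ reducts y z, P ++ w'.1 :: w'.2 :: Q = P₀ ++ w.1 :: w.2 :: Q₀) ↔
      P ++ [y] = P₀ ++ [y₀] ∧ z :: Q = z₀ :: Q₀ := by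
  constructor
  · rintro ⟨w', hw', heq⟩
    rw [List.append_cons P₀, append_cons_cons_eq_iff_of_length_le (by simpa using hlen)
      (by simpa using hlen')] at heq
    obtain ⟨rfl, hw₁⟩ := List.append_inj' heq.1 rfl
    obtain ⟨hw₂, rfl⟩ := List.cons.inj heq.2
    obtain rfl : w' = w := Prod.ext (List.cons.inj hw₁).1 hw₂
    have hblock := (block_eq_of_mem (Finset.mem_of_mem_erase hw)).symm.trans
      (block_eq_of_mem (Finset.mem_of_mem_erase hw'))
    obtain ⟨rfl, rfl⟩ := Prod.mk.inj (hyz₀.eq_of_mem_block (hblock ▸ hyz.mem_block) hyz)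
    exact ⟨rfl, rfl⟩
  · rintro ⟨hy, hz⟩
    obtain ⟨rfl, ⟨⟩⟩ := List.append_inj' hy rfl
    obtain ⟨rfl, rfl⟩ := List.cons.inj hz
    exact ⟨w, hw, rfl⟩

lemma wordEnd_pathWord_pathElt_reduct_apply {y₀ z₀ : E.Letter} {w : E.Letter × E.Letter}
    (hyz₀ : IsRedex c y₀ z₀) (hw : w ∈ reducts y₀ z₀) {P₀ Q₀ : List E.Letter}
    (h : IsNormalPath c l (pathSrc l' x)) (h' : IsNormalPath c l' x)
    (hlen : l.length ≤ P₀.length + 1) (hlen' : l'.length ≤ Q₀.length + 1) :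
    wordEnd R c (pathWord l (pathSrc l' x)) (pathElt R l' x) (P₀ ++ w.1 :: w.2 :: Q₀, x₀) =
      (if l = P₀ ++ [w.1] ∧ l' = w.2 :: Q₀ ∧ x = x₀ then 1 else 0) -
        if l = P₀ ++ [y₀] ∧ l' = z₀ :: Q₀ ∧ x = x₀ then 1 else 0 := by
  have hwr := ((mem_reducts_iff hyz₀).1 hw).2
  have hT : P₀ ++ w.1 :: w.2 :: Q₀ = (P₀ ++ [w.1]) ++ w.2 :: Q₀ := List.append_cons ..
  obtain happ | ⟨P, y, z, Q, rfl, rfl, hyz⟩ := h.append_or_exists_isRedex h'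
  · have hiff : l ++ l' = P₀ ++ [w.1] ++ w.2 :: Q₀ ↔ l = P₀ ++ [w.1] ∧ l' = w.2 :: Q₀ :=
      append_eq_append_iff_of_length_le (by simpa using hlen) hlen'
    simp only [wordEnd_pathWord_pathElt happ, pathElt_apply, hT, hiff, and_assoc]
    refine (sub_eq_self.2 (if_neg ?_)).symm
    rintro ⟨rfl, rfl, -⟩
    exact happ.not_isRedex_of_infix ⟨P₀, Q₀, by simp⟩ hyz₀
  have hlt : P.length + Q.length < (P₀ ++ w.1 :: w.2 :: Q₀).length := by
    simp only [List.length_append, List.length_cons] at hlen hlen' ⊢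
    omega
  have hne : ¬ (P ++ [y] = P₀ ++ [w.1] ∧ z :: Q = w.2 :: Q₀ ∧ x = x₀) := by
    rintro ⟨hy, hz, -⟩
    rw [← (List.cons.inj (List.append_inj' hy rfl).2).1, ← (List.cons.inj hz).1] at hwr
    exact hwr hyz
  refine (wordEnd_pathWord_pathElt_apply_of_isRedex h h' hyz hlt).trans ?_
  simp only [exists_mem_reducts_append_eq_iff hyz hyz₀ hw (by simpa using hlen)
    (by simpa using hlen'), and_assoc, if_neg hne, zero_sub]
  split_ifs
  · rfl
  · exact neg_zero.symm

end

lemma linearMap_eq_sum_pathElt {N : Type*} [AddCommGroup N] [Module R N]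
    (f : E.PathModule R →ₗ[R] N) (m : E.PathModule R) :
    f m = m.sum fun p r => r • f (pathElt R p.1 p.2) := by
  conv_lhs => rw [← Finsupp.sum_single m, map_finsuppSum]
  refine Finsupp.sum_congr fun p _ => ?_
  rw [← map_smul, pathElt, Finsupp.smul_single_one]

lemma act_toFree (m n : E.PathModule R) :
    act R c n (toFree R m) = m.sum fun p r => r • wordEnd R c (pathWord p.1 p.2) n := by
  rw [← LinearMap.comp_apply, linearMap_eq_sum_pathElt]
  refine Finsupp.sum_congr fun p _ => ?_
  rw [LinearMap.comp_apply, toFree_pathElt, word, act_single, one_smul]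

lemma act_toFree_apply (m n : E.PathModule R) (t : List E.Letter × V) :
    act R c n (toFree R m) t = m.sum fun p r => n.sum fun q s =>
      r * (s * wordEnd R c (pathWord p.1 p.2) (pathElt R q.1 q.2) t) := by
  rw [act_toFree, Finsupp.sum_apply]
  refine Finsupp.sum_congr fun p _ => ?_
  rw [linearMap_eq_sum_pathElt, Finsupp.smul_apply, Finsupp.sum_apply, Finsupp.smul_sum]
  rfl

lemma sum_sum_ite_eq {A : Type*} (m n : A →₀ R) (p₀ q₀ : A) :
    (m.sum fun p r => n.sum fun q s => r * (s * if p = p₀ ∧ q = q₀ then 1 else 0)) =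
      m p₀ * n q₀ := by
  have hinner (p : A) (r : R) :
      (n.sum fun q s => r * (s * if p = p₀ ∧ q = q₀ then 1 else 0)) =
        if p = p₀ then r * n q₀ else 0 := by
    split_ifs with hp <;> simp +contextual [hp]
  simp only [hinner]
  simp +contextual

section

variable {m n : E.PathModule R} {v x₀ : V}

lemma act_toFree_append_apply {l₀ l₀' : List E.Letter}
    (hfree : ∀ P y z Q, l₀ = P ++ [y] → l₀' = z :: Q → block y z = ∅)
    (hm : m ∈ normalPaths R c l₀.length ⊓ pathsTo R v)
    (hn : n ∈ normalPaths R c l₀'.length ⊓ pathsFrom R v) :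
    act R c n (toFree R m) (l₀ ++ l₀', x₀) = m (l₀, v) * n (l₀', x₀) := by
  rw [act_toFree_apply, ← sum_sum_ite_eq]
  refine Finsupp.sum_congr fun p hp => Finsupp.sum_congr fun q hq => ?_
  obtain ⟨l, w⟩ := p
  obtain ⟨l', x⟩ := q
  obtain rfl : w = v := hm.2 hp
  obtain rfl : pathSrc l' x = w := hn.2 hq
  obtain ⟨h, hlen⟩ := hm.1 hp
  obtain ⟨h', hlen'⟩ := hn.1 hq
  rw [wordEnd_pathWord_pathElt_append_apply hfree h h' (Nat.cast_le.1 hlen) (Nat.cast_le.1 hlen')]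
  simp only [Prod.mk.injEq, and_true]

lemma act_toFree_reduct_apply {y z : E.Letter} {w : E.Letter × E.Letter} {P Q : List E.Letter}
    (hyz : IsRedex c y z) (hw : w ∈ reducts y z)
    (hm : m ∈ normalPaths R c (P.length + 1) ⊓ pathsTo R v)
    (hn : n ∈ normalPaths R c (Q.length + 1) ⊓ pathsFrom R v) :
    act R c n (toFree R m) (P ++ w.1 :: w.2 :: Q, x₀) =
      m (P ++ [w.1], v) * n (w.2 :: Q, x₀) - m (P ++ [y], v) * n (z :: Q, x₀) := by
  rw [act_toFree_apply, ← sum_sum_ite_eq, ← sum_sum_ite_eq]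
  simp only [Finsupp.sum, ← Finset.sum_sub_distrib, ← mul_sub]
  refine Finset.sum_congr rfl fun p hp => Finset.sum_congr rfl fun q hq => ?_
  obtain ⟨l, v'⟩ := p
  obtain ⟨l', x⟩ := q
  obtain rfl : v' = v := hm.2 hp
  obtain rfl : pathSrc l' x = v' := hn.2 hq
  obtain ⟨h, hlen⟩ := hm.1 hp
  obtain ⟨h', hlen'⟩ := hn.1 hq
  rw [wordEnd_pathWord_pathElt_reduct_apply hyz hw h h' (by exact_mod_cast hlen)
    (by exact_mod_cast hlen')]
  simp only [Prod.mk.injEq, and_true]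

end

lemma act_toFree_mem_normalPaths {m n : E.PathModule R} {v : V} {j k : ℕ}
    (hm : m ∈ normalPaths R c j ⊓ pathsTo R v) (hn : n ∈ normalPaths R c k ⊓ pathsFrom R v) :
    act R c n (toFree R m) ∈ normalPaths R c (j + k : ℕ) := by
  rw [act_toFree]
  refine Submodule.sum_mem _ fun p hp => Submodule.smul_mem _ _ ?_
  obtain rfl : p.2 = v := hm.2 hp
  have hlen : p.1.length + k ≤ j + k := Nat.add_le_add_right (Nat.cast_le.1 (hm.1 hp).2) k
  have hmem := wordEnd_pathWord_mem_normalPaths (hm.1 hp).1 hn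
  exact fun q hq => ⟨(hmem hq).1, (hmem hq).2.trans (by exact_mod_cast hlen)⟩

section

variable (hweight : ∀ α, 2 ≤ E.weight α)
  (hcard : ∀ x, E.NotSink x →
    2 ≤ ((E.outEdges x).filter fun α => E.weight α = E.vertexWeight x).card)
include hweight hcard

lemma exists_mem_block_ne (c : E.SpecialEdges) {y z : E.Letter} {w : E.Letter × E.Letter}
    (hw : w ∈ block y z) : ∃ t ∈ block y z, t ≠ (y, z) := by
  obtain ⟨r, hr, hred⟩ := exists_isRedex_mem_block c hw
  by_cases h : r = (y, z)
  · subst h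
    obtain ⟨t, ht⟩ := hred.reducts_nonempty hweight hcard
    exact ⟨t, Finset.mem_of_mem_erase ht, Finset.ne_of_mem_erase ht⟩
  · exact ⟨r, hr, h⟩

lemma exists_act_toFree_apply_ne_zero [NoZeroDivisors R] {m n : E.PathModule R} {v x : V}
    {l l' : List E.Letter}
    (hm : m ∈ normalPaths R c l.length ⊓ pathsTo R v)
    (hn : n ∈ normalPaths R c l'.length ⊓ pathsFrom R v)
    (hml : m (l, v) ≠ 0) (hnl : n (l', x) ≠ 0) :
    ∃ t : List E.Letter, t.length = l.length + l'.length ∧ act R c n (toFree R m) (t, x) ≠ 0 := by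
  by_cases hfree : ∀ P y z Q, l = P ++ [y] → l' = z :: Q → block y z = ∅
  · refine ⟨l ++ l', List.length_append, ?_⟩
    rw [act_toFree_append_apply hfree hm hn]
    exact mul_ne_zero hml hnl
  push Not at hfree
  obtain ⟨P, y, z, Q, rfl, rfl, w, hw⟩ := hfree
  obtain ⟨⟨y₀, z₀⟩, hr, hred⟩ := exists_isRedex_mem_block c hw
  obtain ⟨⟨y', z'⟩, ht, htne⟩ := exists_mem_block_ne hweight hcard c hw
  by_contra! hzero
  rw [List.length_append, List.length_singleton] at hm
  rw [List.length_cons] at hn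
  have hconst : ∀ w ∈ block y z,
      m (P ++ [w.1], v) * n (w.2 :: Q, x) = m (P ++ [y₀], v) * n (z₀ :: Q, x) := by
    intro w hw
    by_cases hwr : w = (y₀, z₀)
    · rw [hwr]
    · have hwred : w ∈ reducts y₀ z₀ :=
        Finset.mem_erase.2 ⟨hwr, (block_eq_of_mem hr).symm ▸ hw⟩
      rw [← sub_eq_zero, ← act_toFree_reduct_apply hred hwred hm hn]
      exact hzero _ (by grind)
  have htop : m (P ++ [y'], v) * n (z' :: Q, x) ≠ 0 := by
    rw [hconst _ ht, ← hconst (y, z) (self_mem_block_of_mem hw)]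
    exact mul_ne_zero hml hnl
  have hfree' : ∀ P' t u Q', P ++ [y] = P' ++ [t] → z' :: Q = u :: Q' → block t u = ∅ := by
    intro P' t u Q' hP hQ
    rw [← (List.cons.inj (List.append_inj' hP rfl).2).1, ← (List.cons.inj hQ).1]
    exact block_eq_empty_of_mem ht htne
  refine mul_ne_zero hml (right_ne_zero_of_mul htop) ?_
  rw [← act_toFree_append_apply hfree' (by simpa using hm) (by simpa using hn)]
  exact hzero _ (by grind)

lemma pathDegree_act_toFree [NoZeroDivisors R] {m n : E.PathModule R} {v : V}
    (hm : m ∈ normalPaths R c ⊤ ⊓ pathsTo R v) (hn : n ∈ normalPaths R c ⊤ ⊓ pathsFrom R v) :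
    pathDegree (act R c n (toFree R m)) = pathDegree m + pathDegree n := by
  obtain rfl | hm₀ := eq_or_ne m 0
  · rw [map_zero, map_zero, pathDegree_zero, WithBot.bot_add]
  obtain rfl | hn₀ := eq_or_ne n 0
  · simp [act_toFree, pathDegree_zero]
  obtain ⟨⟨l, w⟩, hml, hmdeg⟩ := exists_pathDegree_eq hm₀
  obtain ⟨⟨l', x⟩, hnl, hndeg⟩ := exists_pathDegree_eq hn₀
  obtain rfl : w = v := hm.2 (Finsupp.mem_support_iff.2 hml)
  have hm' := (pathDegree_le_iff hm.1).1 hmdeg.le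
  have hn' := (pathDegree_le_iff hn.1).1 hndeg.le
  rw [hmdeg, hndeg]
  apply le_antisymm
  · exact_mod_cast (pathDegree_le_iff (act_mem_normalPaths _ hn.1)).2
      (act_toFree_mem_normalPaths ⟨hm', hm.2⟩ ⟨hn', hn.2⟩)
  · obtain ⟨t, ht, hne⟩ :=
      exists_act_toFree_apply_ne_zero hweight hcard ⟨hm', hm.2⟩ ⟨hn', hn.2⟩ hml hnl
    exact_mod_cast ht ▸ length_le_pathDegree hne

lemma isLocalValuation_maxLength [NoZeroDivisors R] (c : E.SpecialEdges) :
    IsLocalValuation c fun a : E.LPA R => maxLength c a := by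
  have pathLPA_eq_zero_iff {m : E.PathModule R} (hm : m ∈ normalPaths R c ⊤) :
      pathLPA R m = 0 ↔ m = 0 := by
    rw [← map_zero (pathLPA R)]
    exact (pathLPA_injOn c).eq_iff hm (zero_mem _)
  refine ⟨fun a => ?_, fun a => ?_, fun a b => ?_, ?_⟩
  · obtain ⟨m, hm, rfl⟩ := exists_pathLPA_eq c a
    rw [maxLength_pathLPA hm, pathDegree_eq_bot_iff, pathLPA_eq_zero_iff hm]
  · obtain ⟨m, hm, rfl⟩ := exists_pathLPA_eq c a
    rw [maxLength_pathLPA hm, pathDegree_eq_zero_iff, supp_pathLPA hm, Finset.forall_mem_image,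
      ne_eq (pathLPA R m), pathLPA_eq_zero_iff hm]
    exact and_congr_right fun _ => forall₂_congr fun p hp =>
      (hm hp).1.isTrivial_pathWord_iff.symm
  · obtain ⟨m, hm, rfl⟩ := exists_pathLPA_eq c a
    obtain ⟨n, hn, rfl⟩ := exists_pathLPA_eq c b
    rw [← map_add, maxLength_pathLPA hm, maxLength_pathLPA hn, maxLength_pathLPA (add_mem hm hn)]
    exact pathDegree_add_le m n
  · rintro v _ _ ⟨a, rfl⟩ ⟨b, rfl⟩
    obtain ⟨m, hm, hma⟩ := exists_pathLPA_eq_mul_vertex c a v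
    obtain ⟨n, hn, hnb⟩ := exists_pathLPA_eq_vertex_mul c b v
    change maxLength c (a * letterLPA R (.vertex v) * (letterLPA R (.vertex v) * b)) =
      maxLength c (a * letterLPA R (.vertex v)) + maxLength c (letterLPA R (.vertex v) * b)
    rw [← hma, ← hnb, maxLength_pathLPA hm.1, maxLength_pathLPA hn.1,
      ← pathDegree_act_toFree hweight hcard hm hn,
      ← maxLength_pathLPA (act_mem_normalPaths _ hn.1)]
    exact congrArg (maxLength c) (toLPAHom_mul_pathLPA (toFree R m) hn.1)

end

end WeightedGraph

theorem mainTheorem5_general {V : Type*} {S : Type*} (E : WeightedGraph V S)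
    (hweight : ∀ α, 2 ≤ E.weight α)
    (hcard : ∀ x, E.NotSink x →
      2 ≤ ((E.outEdges x).filter fun α => E.weight α = E.vertexWeight x).card)
    (R : Type*) [Ring R] [NoZeroDivisors R] (c : E.SpecialEdges) :
    (∀ a : E.LPA R, ∃! f : E.FreeRing R, WeightedGraph.IsNormalRep c a f) ∧
      WeightedGraph.IsLocalValuation c
        (fun a : E.LPA R => WeightedGraph.maxLength c a) :=
  ⟨WeightedGraph.existsUnique_isNormalRep c,
    WeightedGraph.isLocalValuation_maxLength hweight hcard c⟩

end

theorem mainTheorem5 {V : Type*} {S : Type*} (E : WeightedGraph V S) (hE : E.IsLV)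
    (R : Type*) [Ring R] [IsDomain R] (c : E.SpecialEdges) :
    (∀ a : E.LPA R, ∃! f : E.FreeRing R, WeightedGraph.IsNormalRep c a f) ∧
      WeightedGraph.IsLocalValuation c
        (fun a : E.LPA R => WeightedGraph.maxLength c a) :=
  mainTheorem5_general E hE.two_le_weight hE.two_le_card R c
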